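/- **Setting.** All $C^*$-algebras are unital, all morphisms are unital $*$-homomorphisms, and $\otimes$ is the minimal tensor product. A *compact matrix quantum group* $G$ is a pair $(C(G),u)$, with $C(G)$ a $C^*$-algebra and $u\in M_N(C(G))$ a unitary matrix whose entries generate $C(G)$, such that $\Delta(u_{ij})=\sum_ku_{ik}\otimes u_{kj}$, $\varepsilon(u_{ij})=\delta_{ij}$, $S(u_{ij})=u_{ji}^*$ define morphisms $\Delta:C(G)\to C(G)\otimes C(G)$, $\varepsilon:C(G)\to\mathbb C$, $S:C(G)\to C(G)^{op}$. Let $C(U_N^*)$ be the universal $C^*$-algebra generated by elements $u_{ij}$ ($1\le i,j\le N$) such that the matrices $(u_{ij})$ and $(u_{ij}^*)$ are unitary and the elements $ab^*,a^*b$, with $a,b\in\{u_{ij}\}$, all commute. A *closed subgroup* $G\subset U_N^*$ is a compact matrix quantum group $G$ together with a morphism $C(U_N^*)\to C(G)$ mapping coordinates to coordinates. The *Hopf image* of a morphism $\pi:C(U_N^*)\to M$ is the smallest closed subgroup $G\subset U_N^*$ such that $\pi$ factorizes through $C(U_N^*)\to C(G)$, and $\pi$ is *stationary on its image* if its image coincides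 with its Hopf image, i.e. if the induced morphism $C(G)\to M$ is injective. Let $L$ be a compact (Hausdorff) group with Haar probability measure, let $v:L\to U_N$ be a continuous $N$-dimensional unitary representation with coefficients $v_{ij}\in C(L)$, let $K\ge1$, and let $\sigma:L\to L$ be an automorphism of topological groups with $\sigma^K=\mathrm{id}$. Put $v_{ij}^{(r)}(g)=v_{ij}(\sigma^r(g))$, and for $x_1,\dots,x_K\in C(L)$ let $\tau[x_1,\dots,x_K]\in M_K(C(L))$ be the matrix with entry $x_1$ at position $(1,K)$, entry $x_r$ at position $(r,r-1)$ for $2\le r\le K$, and all other entries $0$. The associated *cyclic model* is the morphism $$\pi:C(U_N^*)\to M_K(C(L)),\qquad u_{ij}\mapsto\tau[v_{ij}^{(1)},\dots,v_{ij}^{(K)}].$$ Let $L\rtimes\mathbb Z_K$ be the compact quantum group with $C(L\rtimes\mathbb Z_K)=C(L)\rtimes\mathbb Z_K$, the universal $C^*$-algebra generated by a copy of $C(L)$ and a unitary $\tau$ with $\tau^K=1$ and $\tau f\tau^*=f\circ\sigma^{-1}$ for $f\in C(L)$, whose comultiplication extends that of $C(L)$ and satisfies $\Delta(\tau)=\tau\otimes\tau$;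 write $f\otimes\tau^i$ for $f\tau^i$. Let $C([L])\subset C(L\rtimes\mathbb Z_K)$ be the $C^*$-subalgebra generated by the elements $v_{ij}\otimes\tau$. **Theorem 4.4.** The cyclic model $\pi$ exists and is stationary on its image. More precisely, $C([L])$ with the coordinates $u_{ij}=v_{ij}\otimes\tau$ is a compact matrix quantum group $[L]$; the inclusion $C([L])\subset C(L\rtimes\mathbb Z_K)$ intertwines the comultiplications, so that $[L]$ is a quotient of $L\rtimes\mathbb Z_K$; $[L]$ is a closed subgroup of $U_N^*$, and it is the Hopf image of $\pi$; and $\pi$ induces an isomorphism $C([L])\simeq\mathrm{Im}(\pi)$, mapping $v_{ij}\otimes\tau\mapsto\tau[v_{ij}^{(1)},\dots,v_{ij}^{(K)}]$. Moreover the resulting embedding $\theta:C([L])\subset M_K(C(L))$ is stationary, $\int_{[L]}=(tr\otimes\int_L)\theta$, where $\int_{[L]}$ is the Haar integration over $[L]$ and $tr$ is the normalized trace. -/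

import Mathlib

open scoped ENNReal TensorProduct ComplexOrder
open MeasureTheory

universe u v w w'

noncomputable section

/-! ### C*-algebraic preliminaries -/

/-- The bounded product of a family of nonzero unital C*-algebras, with the supremum norm. -/
instance lpInfty.instCStarAlgebra {I : Type*} {B : I → Type*} [∀ i, CStarAlgebra (B i)]
    [∀ i, Nontrivial (B i)] : CStarAlgebra (lp B ∞) where

/-- The unital C*-subalgebra generated by a set. -/
def cstarGenerated {A : Type*} [CStarAlgebra A] (S : Set A) : StarSubalgebra ℂ A :=
  (StarAlgebra.adjoin ℂ S).topologicalClosure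

instance cstarGenerated.isClosed {A : Type*} [CStarAlgebra A] (S : Set A) :
    IsClosed (cstarGenerated S : Set A) :=
  StarSubalgebra.isClosed_topologicalClosure _

theorem mem_cstarGenerated {A : Type*} [CStarAlgebra A] {S : Set A} {a : A} (ha : a ∈ S) :
    a ∈ cstarGenerated S :=
  StarSubalgebra.le_topologicalClosure _ (StarAlgebra.subset_adjoin ℂ S ha)

/-- The entries of a unitary matrix over a C*-algebra have norm at most one. -/
theorem norm_entry_le_one_of_mem_unitary {A : Type*} [CStarAlgebra A] {n : Type*} [Fintype n]
    [DecidableEq n] {x : Matrix n n A} (hx : x ∈ unitary (Matrix n n A)) (i j : n) :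
    ‖x i j‖ ≤ 1 := by
  let := CStarAlgebra.spectralOrder A
  let := CStarAlgebra.spectralOrderedRing A
  nontriviality A
  have h1 : ∑ k, x i k * star (x i k) = 1 := by
    have h0 : x * star x = 1 := (Unitary.mem_iff.1 hx).2
    have h := congrArg (fun M : Matrix n n A => M i i) h0
    simpa [Matrix.mul_apply, Matrix.star_apply] using h
  have h2 : x i j * star (x i j) ≤ 1 := by
    rw [← h1]
    exact Finset.single_le_sum (f := fun k => x i k * star (x i k))
      (fun k _ => mul_star_self_nonneg (x i k)) (Finset.mem_univ j)
  have h3 := CStarAlgebra.norm_le_norm_of_nonneg_of_le (mul_star_self_nonneg (x i j)) h2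
  rw [CStarRing.norm_self_mul_star, norm_one] at h3
  nlinarith [norm_nonneg (x i j)]

/-! ### The minimal (spatial) tensor product -/

/-- A unital `*`-representation of a C*-algebra on a nonzero Hilbert space. -/
structure HilbertRep (A : Type u) [CStarAlgebra A] where
  /-- the Hilbert space -/
  H : Type u
  [normed : NormedAddCommGroup H]
  [inner : InnerProductSpace ℂ H]
  [complete : CompleteSpace H]
  [nontrivial : Nontrivial H]
  /-- the representation -/
  rep : A →⋆ₐ[ℂ] (H →L[ℂ] H)

attribute [instance] HilbertRep.normed HilbertRep.inner HilbertRep.complete HilbertRep.nontrivial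

section MinTensor

variable (A : Type u) (B : Type v) [CStarAlgebra A] [CStarAlgebra B]

/-- The Hilbert space tensor product of the spaces of two representations. -/
abbrev HilbertRep.tensorSpace {A : Type u} {B : Type v} [CStarAlgebra A] [CStarAlgebra B]
    (p : HilbertRep A × HilbertRep B) : Type (max u v) :=
  UniformSpace.Completion (p.1.H ⊗[ℂ] p.2.H)

instance HilbertRep.nontrivial_tensorSpace {A : Type u} {B : Type v} [CStarAlgebra A]
    [CStarAlgebra B] (p : HilbertRep A × HilbertRep B) :
    Nontrivial (HilbertRep.tensorSpace p) := by
  obtain ⟨x, hx⟩ := exists_ne (0 : p.1.H)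
  obtain ⟨y, hy⟩ := exists_ne (0 : p.2.H)
  refine ⟨⟨((x ⊗ₜ[ℂ] y : p.1.H ⊗[ℂ] p.2.H) : HilbertRep.tensorSpace p), 0, fun h => ?_⟩⟩
  have h' := congrArg norm h
  rw [UniformSpace.Completion.norm_coe, TensorProduct.norm_tmul, norm_zero] at h'
  exact (mul_ne_zero (norm_ne_zero_iff.2 hx) (norm_ne_zero_iff.2 hy)) h'

/-- The operator `π(a) ⊗ ρ(b)` on the Hilbert space tensor product. -/
def HilbertRep.tensorOp {A : Type u} {B : Type v} [CStarAlgebra A] [CStarAlgebra B]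
    (p : HilbertRep A × HilbertRep B) (a : A) (b : B) :
    HilbertRep.tensorSpace p →L[ℂ] HilbertRep.tensorSpace p :=
  (TensorProduct.mapL (p.1.rep a) (p.2.rep b)).completion

theorem HilbertRep.norm_tensorOp_le {A : Type u} {B : Type v} [CStarAlgebra A] [CStarAlgebra B]
    (p : HilbertRep A × HilbertRep B) (a : A) (b : B) :
    ‖HilbertRep.tensorOp p a b‖ ≤ ‖a‖ * ‖b‖ := by
  have h1 : ‖HilbertRep.tensorOp p a b‖ ≤ ‖TensorProduct.mapL (p.1.rep a) (p.2.rep b)‖ := by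
    refine ContinuousLinearMap.opNorm_le_bound _ (ContinuousLinearMap.opNorm_nonneg _) fun x => ?_
    induction x using UniformSpace.Completion.induction_on with
    | hp => exact isClosed_le (by fun_prop) (by fun_prop)
    | ih x =>
      have h : HilbertRep.tensorOp p a b (x : HilbertRep.tensorSpace p) =
          ((TensorProduct.mapL (p.1.rep a) (p.2.rep b) x : p.1.H ⊗[ℂ] p.2.H) :
            HilbertRep.tensorSpace p) := by
        simp [HilbertRep.tensorOp]
      rw [h, UniformSpace.Completion.norm_coe, UniformSpace.Completion.norm_coe]
      exact ContinuousLinearMap.le_opNorm _ _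
  refine h1.trans ((TensorProduct.norm_mapL_le _ _).trans ?_)
  gcongr
  · exact NonUnitalStarAlgHom.norm_apply_le _ _
  · exact NonUnitalStarAlgHom.norm_apply_le _ _

/-- The bounded product of the algebras `B(H ⊗ H')`, over all pairs of Hilbert space
representations of `A` on `H` and of `B` on `H'`. -/
abbrev MinTensorAmbient : Type (max (u + 1) (v + 1)) :=
  lp (fun p : HilbertRep.{u} A × HilbertRep.{v} B =>
    HilbertRep.tensorSpace p →L[ℂ] HilbertRep.tensorSpace p) ∞

instance MinTensorAmbient.instCStarAlgebra : CStarAlgebra (MinTensorAmbient A B) :=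
  lpInfty.instCStarAlgebra (I := HilbertRep.{u} A × HilbertRep.{v} B)
    (B := fun p => HilbertRep.tensorSpace p →L[ℂ] HilbertRep.tensorSpace p)

variable {A B} in
/-- The family `(π(a) ⊗ ρ(b))`, over all pairs `(π, ρ)`. -/
def minTensorAmbientTmul (a : A) (b : B) : MinTensorAmbient A B :=
  ⟨fun p => HilbertRep.tensorOp p a b, memℓp_infty ⟨‖a‖ * ‖b‖, by
    rintro _ ⟨p, rfl⟩
    exact HilbertRep.norm_tensorOp_le p a b⟩⟩

/-- The minimal (spatial) C*-tensor product `A ⊗ B`: the completion of the algebraic tensor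
product for the norm `‖x‖ = sup ‖(π ⊗ ρ)(x)‖`, the supremum being over all pairs of Hilbert space
representations of `A` and `B`. -/
abbrev MinTensor : Type (max (u + 1) (v + 1)) :=
  cstarGenerated (Set.range fun p : A × B => minTensorAmbientTmul p.1 p.2)

variable {A B} in
/-- The elementary tensor `a ⊗ b`. -/
def minTmul (a : A) (b : B) : MinTensor A B :=
  ⟨minTensorAmbientTmul a b, mem_cstarGenerated ⟨(a, b), rfl⟩⟩

end MinTensor

/-! ### Compact matrix quantum groups -/

section QuantumGroups

variable {A : Type u} [CStarAlgebra A] {N : ℕ}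

/-- `Δ : A → A ⊗ A` is given by `Δ(u_ij) = ∑_k u_ik ⊗ u_kj`. -/
def IsMatrixComul (x : Matrix (Fin N) (Fin N) A) (Δ : A →⋆ₐ[ℂ] MinTensor A A) : Prop :=
  ∀ i j, Δ (x i j) = ∑ k, minTmul (x i k) (x k j)

/-- The pair `(A, x)` is `(C(G), u)` for a compact matrix quantum group `G` with fundamental
corepresentation `u`: the matrix `x` is unitary, its entries generate `A`, and the usual formulae
define morphisms of C*-algebras `Δ : A → A ⊗ A`, `ε : A → ℂ`, `S : A → A^op`. -/
structure IsCompactMatrixQuantumGroup (x : Matrix (Fin N) (Fin N) A) : Prop where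
  isUnitary : x ∈ unitary (Matrix (Fin N) (Fin N) A)
  generates : cstarGenerated (Set.range fun p : Fin N × Fin N => x p.1 p.2) = ⊤
  comul : ∃ Δ : A →⋆ₐ[ℂ] MinTensor A A, IsMatrixComul x Δ
  counit : ∃ ε : A →⋆ₐ[ℂ] ℂ, ∀ i j, ε (x i j) = if i = j then 1 else 0
  antipode : ∃ S : A →⋆ₐ[ℂ] Aᵐᵒᵖ, ∀ i j, S (x i j) = MulOpposite.op (star (x j i))

/-- States of a unital C*-algebra. -/
def IsState (φ : A →ₗ[ℂ] ℂ) : Prop :=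
  (∀ a, 0 ≤ φ (star a * a)) ∧ φ 1 = 1

/-- `ω` is the product functional `φ ⊗ ψ` on the minimal tensor product. -/
def IsProductFunctional {B : Type v} [CStarAlgebra B] (φ : A →ₗ[ℂ] ℂ) (ψ : B →ₗ[ℂ] ℂ)
    (ω : MinTensor A B →L[ℂ] ℂ) : Prop :=
  ∀ a b, ω (minTmul a b) = φ a * ψ b

/-- `h` is the Haar integration with respect to the comultiplication `Δ`: it is a state, and
`(h ⊗ φ)Δ = h = (φ ⊗ h)Δ` for every state `φ`. -/
structure IsHaarIntegration (Δ : A →⋆ₐ[ℂ] MinTensor A A) (h : A →ₗ[ℂ] ℂ) : Prop where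
  isState : IsState h
  left : ∀ φ : A →ₗ[ℂ] ℂ, IsState φ →
    ∃ ω : MinTensor A A →L[ℂ] ℂ, IsProductFunctional h φ ω ∧ ∀ a, ω (Δ a) = h a
  right : ∀ φ : A →ₗ[ℂ] ℂ, IsState φ →
    ∃ ω : MinTensor A A →L[ℂ] ℂ, IsProductFunctional φ h ω ∧ ∀ a, ω (Δ a) = h a

/-- The injective morphism `ι : A → D` intertwines the comultiplications, `(ι ⊗ ι)Δ = Δ'ι`; so if
`A = C(G)` and `D = C(H)`, then `G` is, via `ι`, a quotient quantum group of `H`. -/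
def IsQuotientEmbedding {D : Type v} [CStarAlgebra D] (Δ : A →⋆ₐ[ℂ] MinTensor A A)
    (Δ' : D →⋆ₐ[ℂ] MinTensor D D) (ι : A →⋆ₐ[ℂ] D) : Prop :=
  Function.Injective ι ∧ ∃ J : MinTensor A A →⋆ₐ[ℂ] MinTensor D D,
    (∀ a b, J (minTmul a b) = minTmul (ι a) (ι b)) ∧ ∀ a, J (Δ a) = Δ' (ι a)

end QuantumGroups

/-! ### Matrix models, Hopf images, stationarity -/

section Models

variable {C : Type u} [CStarAlgebra C] {N : ℕ} {M : Type v} [CStarAlgebra M]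

/-- Let `C = C(G)` with standard coordinates `x`. A morphism `q : C → A` is a closed quantum
subgroup of `G` when `A`, with the coordinates `q(x_ij)`, is a compact matrix quantum group.
(Such a `q` is automatically surjective.) -/
def IsClosedQuantumSubgroup (x : Matrix (Fin N) (Fin N) C) {A : Type w} [CStarAlgebra A]
    (q : C →⋆ₐ[ℂ] A) : Prop :=
  IsCompactMatrixQuantumGroup (fun i j => q (x i j) : Matrix (Fin N) (Fin N) A)

/-- `q : C → A` is the Hopf image of the model `π : C → M`: it is the smallest closed quantum
subgroup through which `π` factorizes. -/
structure IsHopfImage (x : Matrix (Fin N) (Fin N) C) (π : C →⋆ₐ[ℂ] M) {A : Type w}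
    [CStarAlgebra A] (q : C →⋆ₐ[ℂ] A) : Prop where
  subgroup : IsClosedQuantumSubgroup x q
  factors : ∃ θ : A →⋆ₐ[ℂ] M, θ.comp q = π
  smallest : ∀ (A' : Type w') [CStarAlgebra A'] (q' : C →⋆ₐ[ℂ] A'),
    IsClosedQuantumSubgroup x q' → (∃ θ' : A' →⋆ₐ[ℂ] M, θ'.comp q' = π) →
      ∃ r : A' →⋆ₐ[ℂ] A, r.comp q' = q

/-- The model `π : C → M` is stationary on its image: its image coincides with its Hopf image.
Here `q : C → A` is the Hopf image, and `θ : A → M` identifies it with the image of `π`. -/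
structure IsStationaryOnImage (x : Matrix (Fin N) (Fin N) C) (π : C →⋆ₐ[ℂ] M) {A : Type w}
    [CStarAlgebra A] (q : C →⋆ₐ[ℂ] A) (θ : A →⋆ₐ[ℂ] M) : Prop where
  hopfImage : IsHopfImage.{u, v, w, w'} x π q
  factors : θ.comp q = π
  injective : Function.Injective θ
  range_eq : Set.range θ = Set.range π

/-- The matrix model `θ : A → M_K(C(X))` is stationary: `∫_G = (tr ⊗ ∫_X) θ`, where `A = C(G)`,
`∫_G` is the Haar integration, and `tr` is the normalized trace. -/
def IsStationaryModel {A : Type w} [CStarAlgebra A] (Δ : A →⋆ₐ[ℂ] MinTensor A A) {K : ℕ}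
    {X : Type v} [TopologicalSpace X] [CompactSpace X] [MeasurableSpace X] (μ : Measure X)
    (θ : A →⋆ₐ[ℂ] CStarMatrix (Fin K) (Fin K) C(X, ℂ)) : Prop :=
  ∃ h : A →ₗ[ℂ] ℂ, IsHaarIntegration Δ h ∧
    ∀ a, h a = (K : ℂ)⁻¹ * ∑ r, ∫ g, (θ a r r : C(X, ℂ)) g ∂μ

end Models

/-! ### The half-liberated unitary group -/

section HalfLiberated

/-- The defining relations of `C(U_N^*)`: the matrices `(x_ij)` and `(x_ij^*)` are unitary, and the
elements `ab^*`, `a^*b`, with `a, b` among the entries `x_ij`, all commute. -/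
structure IsHalfLiberated {B : Type u} [CStarAlgebra B] {N : ℕ}
    (x : Matrix (Fin N) (Fin N) B) : Prop where
  isUnitary : x ∈ unitary (Matrix (Fin N) (Fin N) B)
  isUnitary_conj : x.map star ∈ unitary (Matrix (Fin N) (Fin N) B)
  commute : ∀ s ∈ {y | ∃ i j k l, y = x i j * star (x k l) ∨ y = star (x i j) * x k l},
    ∀ t ∈ {y | ∃ i j k l, y = x i j * star (x k l) ∨ y = star (x i j) * x k l}, Commute s t

/-- An `N × N` matrix satisfying the half-liberation relations, over some nonzero C*-algebra. -/
structure HalfLiberatedMatrix (N : ℕ) : Type (u + 1) where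
  /-- the C*-algebra -/
  B : Type u
  [cstar : CStarAlgebra B]
  [nontrivial : Nontrivial B]
  /-- the matrix -/
  coord : Matrix (Fin N) (Fin N) B
  rel : IsHalfLiberated coord

attribute [instance] HalfLiberatedMatrix.cstar HalfLiberatedMatrix.nontrivial

/-- The bounded product of the C*-algebras containing half-liberated matrices. -/
abbrev HalfLiberatedAmbient (N : ℕ) : Type (u + 1) :=
  lp (fun p : HalfLiberatedMatrix.{u} N => p.B) ∞

/-- The universal family of half-liberated matrices. -/
def halfLiberatedAmbientCoord {N : ℕ} (i j : Fin N) : HalfLiberatedAmbient.{u} N :=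
  ⟨fun p => p.coord i j, memℓp_infty ⟨1, by
    rintro _ ⟨p, rfl⟩
    exact norm_entry_le_one_of_mem_unitary p.rel.isUnitary i j⟩⟩

/-- `C(U_N^*)`: the universal C*-algebra generated by the entries of a half-liberated matrix, that
is, the completion of the free unital `*`-algebra on these entries for the supremum of the
seminorms coming from all its representations by half-liberated matrices. (A finitely generated
C*-algebra has a copy in each universe, so that the choice of a universe is immaterial.) -/
abbrev CUNStar (N : ℕ) : Type (u + 1) :=
  cstarGenerated (Set.range fun p : Fin N × Fin N => halfLiberatedAmbientCoord.{u} p.1 p.2)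

/-- The standard coordinates of `U_N^*`. -/
def unStarCoord {N : ℕ} : Matrix (Fin N) (Fin N) (CUNStar.{u} N) := fun i j =>
  ⟨halfLiberatedAmbientCoord i j, mem_cstarGenerated ⟨(i, j), rfl⟩⟩

end HalfLiberated

/-! ### The compact quantum group `L ⋊ ℤ_K` and the cyclic models -/

section Cyclic

variable {L : Type u} [Group L] [TopologicalSpace L] [CompactSpace L]

/-- The automorphism `f ↦ f ∘ σ⁻¹` of `C(L)` is the action of the generator of `ℤ_K`.
A covariant pair for this action, in a nonzero C*-algebra `B`: a morphism `φ : C(L) → B` and a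
unitary `t` of order dividing `K`, satisfying `t φ(f) t^* = φ(f ∘ σ⁻¹)`. -/
structure CovariantPair (σ : L ≃ₜ* L) (K : ℕ) : Type (u + 1) where
  /-- the C*-algebra -/
  B : Type u
  [cstar : CStarAlgebra B]
  [nontrivial : Nontrivial B]
  /-- the morphism -/
  φ : C(L, ℂ) →⋆ₐ[ℂ] B
  /-- the unitary -/
  t : B
  isUnitary : t ∈ unitary B
  pow_eq : t ^ K = 1
  covariant : ∀ f : C(L, ℂ), t * φ f * star t = φ (f.comp (σ.symm : C(L, L)))

attribute [instance] CovariantPair.cstar CovariantPair.nontrivial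

variable (σ : L ≃ₜ* L) (K : ℕ)

/-- The bounded product of the targets of all covariant pairs. -/
abbrev CrossedAmbient : Type (u + 1) :=
  lp (fun p : CovariantPair σ K => p.B) ∞

/-- The universal copy of `C(L)`. -/
def crossedAmbientFun (f : C(L, ℂ)) : CrossedAmbient σ K :=
  ⟨fun p => p.φ f, memℓp_infty ⟨‖f‖, by
    rintro _ ⟨p, rfl⟩
    exact NonUnitalStarAlgHom.norm_apply_le p.φ f⟩⟩

/-- The universal implementing unitary. -/
def crossedAmbientGen : CrossedAmbient σ K :=
  ⟨fun p => p.t, memℓp_infty ⟨1, by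
    rintro _ ⟨p, rfl⟩
    exact (CStarRing.norm_of_mem_unitary p.isUnitary).le⟩⟩

/-- `C(L ⋊ ℤ_K)`: the crossed product C*-algebra `C(L) ⋊ ℤ_K`, that is, the universal C*-algebra
generated by a covariant pair. -/
abbrev CCrossed : Type (u + 1) :=
  cstarGenerated (Set.range (crossedAmbientFun σ K) ∪ {crossedAmbientGen σ K})

/-- The element `f ⊗ 1` of `C(L ⋊ ℤ_K)`. -/
def crossedFun (f : C(L, ℂ)) : CCrossed σ K :=
  ⟨crossedAmbientFun σ K f, mem_cstarGenerated (Or.inl ⟨f, rfl⟩)⟩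

/-- The element `1 ⊗ τ` of `C(L ⋊ ℤ_K)`. -/
def crossedGen : CCrossed σ K :=
  ⟨crossedAmbientGen σ K, mem_cstarGenerated (Or.inr rfl)⟩

/-- `Δ` is the comultiplication of `L ⋊ ℤ_K`: it extends the comultiplication `f(gh)` of `C(L)`,
and the element `τ` is group-like. -/
structure IsCrossedComul (Δ : CCrossed σ K →⋆ₐ[ℂ] MinTensor (CCrossed σ K) (CCrossed σ K)) :
    Prop where
  fun_eq : ∀ (f : C(L, ℂ)) (n : ℕ) (a b : Fin n → C(L, ℂ)),
    (∀ g h, f (g * h) = ∑ m, a m g * b m h) →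
      Δ (crossedFun σ K f) = ∑ m, minTmul (crossedFun σ K (a m)) (crossedFun σ K (b m))
  gen_eq : Δ (crossedGen σ K) = minTmul (crossedGen σ K) (crossedGen σ K)

variable {N : ℕ} (v : L →ₜ* Matrix.unitaryGroup (Fin N) ℂ)

/-- The coefficient `v_ij ∈ C(L)` of the unitary representation `v`. -/
def repCoeff (i j : Fin N) : C(L, ℂ) where
  toFun g := (v g : Matrix (Fin N) (Fin N) ℂ) i j
  continuous_toFun := (continuous_subtype_val.comp v.continuous_toFun).matrix_elem i j

/-- The function `v_ij^(m)(g) = v_ij(σ^m(g))`. -/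
def repCoeffIter (m : ℕ) (i j : Fin N) : C(L, ℂ) where
  toFun g := repCoeff v i j (σ^[m] g)
  continuous_toFun := (repCoeff v i j).continuous.comp (σ.continuous.iterate m)

/-- The coordinates `u_ij = v_ij ⊗ τ` of `[L]`, inside `C(L ⋊ ℤ_K)`. -/
def bracketAmbientCoord (i j : Fin N) : CCrossed σ K :=
  crossedFun σ K (repCoeff v i j) * crossedGen σ K

/-- `C([L])`: the C*-subalgebra of `C(L ⋊ ℤ_K)` generated by the coordinates `v_ij ⊗ τ`. -/
def cBracket : StarSubalgebra ℂ (CCrossed σ K) :=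
  cstarGenerated (Set.range fun p : Fin N × Fin N => bracketAmbientCoord σ K v p.1 p.2)

instance cBracket.isClosed : IsClosed (cBracket σ K v : Set (CCrossed σ K)) :=
  cstarGenerated.isClosed _

/-- The standard coordinates of `[L]`. -/
def bracketCoord : Matrix (Fin N) (Fin N) (cBracket σ K v) := fun i j =>
  ⟨bracketAmbientCoord σ K v i j, mem_cstarGenerated ⟨(i, j), rfl⟩⟩

/-- The matrix `τ[x_1, …, x_K]`, obtained by filling the standard `K`-cycle: `x_1` sits at position
`(1, K)`, and `x_r` at position `(r, r - 1)` for `r ≥ 2`. (Rows and columns are numbered from `0`,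
so that `x_{r+1}` is `x r`.) -/
def cycleFill {R : Type*} [Zero R] (K : ℕ) [NeZero K] (x : Fin K → R) :
    CStarMatrix (Fin K) (Fin K) R :=
  CStarMatrix.ofMatrix fun r s => if r = s + 1 then x r else 0

/-- The cyclic model `C(U_N^*) → M_K(C(L))`, `u_ij ↦ τ[v_ij^(1), …, v_ij^(K)]`. -/
def IsCyclicModel [NeZero K]
    (π : CUNStar.{u} N →⋆ₐ[ℂ] CStarMatrix (Fin K) (Fin K) C(L, ℂ)) : Prop :=
  ∀ i j, π (unStarCoord i j) =
    cycleFill K fun r : Fin K => repCoeffIter σ v ((r : ℕ) + 1) i j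

end Cyclic

end

/-!
The argument takes place in `M_K(C(L))`. The matrices `diag(f ∘ σ, …, f ∘ σ^K)` and the matrix of
the standard `K`-cycle form a covariant pair (`isCovariant_regular`), which defines the regular
representation `Θ` of `C(L) ⋊ ℤ_K`. The coefficients of `∑ f_i τ^i` appear in the first column of
its image, so that every element of the crossed product is such a sum, and `Θ` is faithful
(`IsCrossedProduct.of_regular`, `IsCrossedProduct.exists_coeff`,
`IsCrossedProduct.injective_regular`). Since `Θ(v_ij τ) = τ[v_ij^(1), …, v_ij^(K)]`, the cyclic
model and the restriction `θ` of `Θ` to `C([L])` agree on coordinates. This gives `π = θ q` with `θ`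
injective, and any factorization of `π` through a closed subgroup `A'` maps onto `C([L])`, because
its image in `M_K(C(L))` is generated by the same matrices (`IsBracket.exists_stationaryOnImage`).
The half-liberation relations hold because all products `ab^*`, `a^*b` of coordinates lie in `C(L)`
(`IsCovariant.isHalfLiberated`).

For the quantum group structure, the commuting copies of `C(L)` in the two factors of
`C(L ⋊ ℤ_K) ⊗ C(L ⋊ ℤ_K)` extend to a morphism on `C(L × L)` by Gelfand duality
(`ContinuousMap.exists_starAlgHom_prod`). Together with `τ ⊗ τ` it forms a covariant pair, and the
universal property yields the comultiplication (`IsCrossedProduct.exists_comul`). It restricts to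
`C([L])` because `C([L]) ⊗ C([L])` embeds into `C(L ⋊ ℤ_K) ⊗ C(L ⋊ ℤ_K)`
(`MinT.exists_map_injective`): the minimal tensor product is represented faithfully by the tensor
product of faithful representations (`MinT.eq_zero_of_eval_eq_zero`).

The state `(tr ⊗ ∫_L)Θ` vanishes on `f τ^n` unless `K` divides `n`, and equals `∫_L f` otherwise. It
is faithful, so its GNS representation provides slice maps (`MinT.exists_leftSlice`,
`MinT.exists_rightSlice`), and its invariance follows from that of the Haar measure
(`IsCrossedProduct.leftSlice_comul`, `IsCrossedProduct.rightSlice_comul`).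

The crossed product and its subalgebra enter only through the properties collected in `IsBracket`,
and the minimal tensor product only through its copy `MinT`; the objects of the statement appear
at the end.
-/

/-! ### Morphisms of C*-algebras: closed range, generators, lifting through injections -/

section CStarMorphisms

open scoped CStarAlgebra

variable {A : Type*} {B : Type*} {E : Type*} [CStarAlgebra A] [CStarAlgebra B] [CStarAlgebra E]

theorem cstarGenerated_le {S : Set A} {T : StarSubalgebra ℂ A} (hT : IsClosed (T : Set A))
    (h : S ⊆ T) : cstarGenerated S ≤ T :=
  StarSubalgebra.topologicalClosure_minimal (StarAlgebra.adjoin_le h) hT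

/-- A self-adjoint element of the range has a preimage of no larger norm: cut off any self-adjoint
preimage by continuous functional calculus. -/
theorem StarAlgHom.exists_preimage_norm_le_of_isSelfAdjoint (f : A →⋆ₐ[ℂ] B) {a : A}
    (ha : IsSelfAdjoint a) : ∃ a', f a' = f a ∧ ‖a'‖ ≤ ‖f a‖ := by
  set c : ℝ := ‖f a‖
  have hc : 0 ≤ c := norm_nonneg _
  set g : ℝ → ℝ := fun x => max (-c) (min c x)
  refine ⟨cfc g a, ?_, ?_⟩
  · have hfa : IsSelfAdjoint (f a) := ha.map f
    have h1 : f (cfc g a) = cfc g (f a) :=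
      StarAlgHomClass.map_cfc (R := ℝ) (S := ℂ) f g a (hf := by fun_prop)
        (hφ := map_continuous f)
    rw [h1]
    conv_rhs => rw [← cfc_id ℝ (f a)]
    refine cfc_congr fun x hx => ?_
    have hx' : |x| ≤ c := by
      rcases subsingleton_or_nontrivial B with hB | hB
      · simp [spectrum.of_subsingleton] at hx
      · simpa using spectrum.norm_le_norm_of_mem hx
    rw [abs_le] at hx'
    simp only [g, id]
    rw [min_eq_right hx'.2, max_eq_right hx'.1]
  · refine norm_cfc_le hc fun x _ => ?_
    rw [Real.norm_eq_abs, abs_le]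
    exact ⟨le_max_left _ _, max_le (by linarith) (min_le_left _ _)⟩

open scoped ComplexStarModule in
theorem StarAlgHom.exists_preimage_norm_le (f : A →⋆ₐ[ℂ] B) (a : A) :
    ∃ a', f a' = f a ∧ ‖a'‖ ≤ 2 * ‖f a‖ := by
  obtain ⟨x, hx, hxn⟩ := f.exists_preimage_norm_le_of_isSelfAdjoint (ℜ a).2
  obtain ⟨y, hy, hyn⟩ := f.exists_preimage_norm_le_of_isSelfAdjoint (ℑ a).2
  have hre : f (ℜ a : A) = (ℜ (f a) : B) := by
    rw [realPart_apply_coe, realPart_apply_coe, ← Complex.coe_smul, map_smul, map_add, map_star,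
      Complex.coe_smul]
  have him : f (ℑ a : A) = (ℑ (f a) : B) := by
    rw [imaginaryPart_apply_coe, imaginaryPart_apply_coe, map_smul, ← Complex.coe_smul, map_smul,
      map_sub, map_star, Complex.coe_smul]
  refine ⟨x + Complex.I • y, ?_, ?_⟩
  · rw [map_add, map_smul, hx, hy, ← map_smul, ← map_add, realPart_add_I_smul_imaginaryPart]
  · calc ‖x + Complex.I • y‖ ≤ ‖x‖ + ‖y‖ := by
          refine (norm_add_le _ _).trans ?_
          rw [norm_smul, Complex.norm_I, one_mul]
      _ ≤ ‖(ℜ (f a) : B)‖ + ‖(ℑ (f a) : B)‖ := by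
          rw [← hre, ← him]; gcongr
      _ ≤ 2 * ‖f a‖ := by
          have h1 := realPart.norm_le (f a)
          have h2 := imaginaryPart.norm_le (f a)
          simp only [AddSubgroup.coe_norm] at h1 h2
          linarith

/-- The range of a morphism of C*-algebras is closed. -/
theorem StarAlgHom.isClosed_range (f : A →⋆ₐ[ℂ] B) : IsClosed (Set.range f) := by
  let F : NormedAddGroupHom A B :=
    { toFun := f
      map_add' := map_add f
      bound' := ⟨1, fun a => by simpa using NonUnitalStarAlgHom.norm_apply_le f a⟩ }
  have h := controlled_closure_of_complete (f := F) (K := F.range) (C := 2) (ε := 1)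
    (by norm_num) (by norm_num) (by
      rintro _ ⟨a, rfl⟩
      exact f.exists_preimage_norm_le a)
  refine isClosed_of_closure_subset fun b hb => ?_
  obtain ⟨a, ha, -⟩ := h b hb
  exact ⟨a, ha⟩

/-- A morphism of C*-algebras as a bounded operator. -/
def StarAlgHom.toCLM (f : A →⋆ₐ[ℂ] B) : A →L[ℂ] B where
  toLinearMap := f.toAlgHom.toLinearMap
  cont := map_continuous f

theorem StarAlgHom.toCLM_apply (f : A →⋆ₐ[ℂ] B) (a : A) : f.toCLM a = f a := rfl

theorem StarAlgHom.surjective_of_cstarGenerated_eq_top (f : A →⋆ₐ[ℂ] B) {S : Set B}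
    (hS : cstarGenerated S = ⊤) (h : S ⊆ Set.range f) : Function.Surjective f := by
  have h1 : cstarGenerated S ≤ f.range := cstarGenerated_le f.isClosed_range h
  rw [hS] at h1
  intro b
  exact h1 (StarSubalgebra.mem_top (R := ℂ) (x := b))

/-- A morphism defined on generators with values in a C*-subalgebra takes values there. -/
theorem StarAlgHom.exists_lift_of_injective {S : Set A} (hS : cstarGenerated S = ⊤)
    (f : A →⋆ₐ[ℂ] E) (j : B →⋆ₐ[ℂ] E) (hj : Function.Injective j)
    (h : ∀ s ∈ S, f s ∈ Set.range j) : ∃ g : A →⋆ₐ[ℂ] B, ∀ a, j (g a) = f a := by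
  have hcl : IsClosed ((j.range.comap f : StarSubalgebra ℂ A) : Set A) :=
    j.isClosed_range.preimage (map_continuous f)
  have h1 : cstarGenerated S ≤ j.range.comap f := cstarGenerated_le hcl fun s hs => by
    obtain ⟨b, hb⟩ := h s hs
    exact ⟨b, hb⟩
  rw [hS] at h1
  have h2 : ∀ a, f a ∈ j.range := fun a => h1 (StarSubalgebra.mem_top (R := ℂ) (x := a))
  refine ⟨((StarAlgEquiv.ofInjective j hj).symm : j.range →⋆ₐ[ℂ] B).comp
    (f.codRestrict j.range h2), fun a => ?_⟩
  have := (StarAlgEquiv.ofInjective j hj).apply_symm_apply (f.codRestrict j.range h2 a)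
  exact congrArg Subtype.val this

/-- A generating set of a C*-subalgebra generates it as a C*-algebra of its own. -/
theorem cstarGenerated_eq_top_of_le {D : StarSubalgebra ℂ A} [hD : IsClosed (D : Set A)]
    {T : Set D} (h : D ≤ cstarGenerated (Subtype.val '' T)) : cstarGenerated T = ⊤ := by
  have h1 : cstarGenerated (Subtype.val '' T) ≤ (cstarGenerated T).map D.subtype :=
    cstarGenerated_le (by
      rw [StarSubalgebra.coe_map]
      exact hD.isClosedEmbedding_subtypeVal.isClosedMap _ (cstarGenerated.isClosed T)) (by
      rintro _ ⟨t, ht, rfl⟩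
      exact ⟨t, mem_cstarGenerated ht, rfl⟩)
  refine eq_top_iff.2 fun d _ => ?_
  obtain ⟨t, ht, hd⟩ := h1 (h d.2)
  have : t = d := Subtype.ext hd
  exact this ▸ ht

/-- If a generating set is closed under products and adjoints, then it is total. -/
theorem mem_closure_span_of_cstarGenerated {S : Set A} (hS : cstarGenerated S = ⊤) (h1 : 1 ∈ S)
    (hmul : ∀ x ∈ S, ∀ y ∈ S, x * y ∈ S) (hstar : ∀ x ∈ S, star x ∈ S) (x : A) :
    x ∈ closure (Submodule.span ℂ S : Set A) := by
  let W : StarSubalgebra ℂ A :=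
    { carrier := Submodule.span ℂ S
      add_mem' := Submodule.add_mem _
      mul_mem' := fun {x y} hx hy => by
        refine Submodule.span_induction₂ (p := fun x y _ _ => x * y ∈ Submodule.span ℂ S)
          (fun x y hx hy => Submodule.subset_span (hmul x hx y hy)) ?_ ?_ ?_ ?_ ?_ ?_ hx hy
        · intro y _; rw [zero_mul]; exact Submodule.zero_mem _
        · intro x _; rw [mul_zero]; exact Submodule.zero_mem _
        · intro x y z _ _ _ h1 h2; rw [add_mul]; exact Submodule.add_mem _ h1 h2
        · intro x y z _ _ _ h1 h2; rw [mul_add]; exact Submodule.add_mem _ h1 h2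
        · intro r x y _ _ h; rw [smul_mul_assoc]; exact Submodule.smul_mem _ _ h
        · intro r x y _ _ h; rw [mul_smul_comm]; exact Submodule.smul_mem _ _ h
      algebraMap_mem' := fun c => by
        rw [Algebra.algebraMap_eq_smul_one]
        exact Submodule.smul_mem _ _ (Submodule.subset_span h1)
      star_mem' := fun {x} hx => by
        change star x ∈ Submodule.span ℂ S
        change x ∈ Submodule.span ℂ S at hx
        induction hx using Submodule.span_induction with
        | mem y hy => exact Submodule.subset_span (hstar y hy)
        | zero => rw [star_zero]; exact Submodule.zero_mem _
        | add y z _ _ hy hz => rw [star_add]; exact Submodule.add_mem _ hy hz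
        | smul c y _ hy => rw [star_smul]; exact Submodule.smul_mem _ _ hy }
  have h : cstarGenerated S ≤ W.topologicalClosure :=
    cstarGenerated_le (StarSubalgebra.isClosed_topologicalClosure _)
      (Submodule.subset_span.trans subset_closure)
  rw [hS] at h
  exact h (StarSubalgebra.mem_top (R := ℂ) (x := x))

end CStarMorphisms

/-! ### Elementary tensors in the minimal tensor product -/

noncomputable section MinTensorAlgebra

open scoped CStarAlgebra InnerProductSpace
open UniformSpace

section Operators

variable {A : Type u} {B : Type v} [CStarAlgebra A] [CStarAlgebra B]
  (p : HilbertRep A × HilbertRep B)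

/-- The elementary tensor `x ⊗ y` in the Hilbert space tensor product. -/
def HilbertRep.tensorVec (x : p.1.H) (y : p.2.H) : HilbertRep.tensorSpace p :=
  ((x ⊗ₜ[ℂ] y : p.1.H ⊗[ℂ] p.2.H) : HilbertRep.tensorSpace p)

theorem HilbertRep.tensorOp_tensorVec (a : A) (b : B) (x : p.1.H) (y : p.2.H) :
    HilbertRep.tensorOp p a b (HilbertRep.tensorVec p x y) =
      HilbertRep.tensorVec p (p.1.rep a x) (p.2.rep b y) := by
  simp [HilbertRep.tensorOp, HilbertRep.tensorVec]

theorem HilbertRep.inner_tensorVec (x x' : p.1.H) (y y' : p.2.H) :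
    ⟪HilbertRep.tensorVec p x y, HilbertRep.tensorVec p x' y'⟫_ℂ = ⟪x, x'⟫_ℂ * ⟪y, y'⟫_ℂ := by
  simp [HilbertRep.tensorVec]

/-- Elementary tensors are total in the Hilbert space tensor product. -/
theorem HilbertRep.tensorSpace_induction {P : HilbertRep.tensorSpace p → Prop}
    (closed : IsClosed {z | P z}) (vec : ∀ x y, P (HilbertRep.tensorVec p x y))
    (add : ∀ z z', P z → P z' → P (z + z')) (z : HilbertRep.tensorSpace p) : P z := by
  induction z using Completion.induction_on with
  | hp => exact closed
  | ih z =>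
    induction z using TensorProduct.induction_on with
    | zero => simpa [HilbertRep.tensorVec] using vec 0 0
    | tmul x y => exact vec x y
    | add z z' hz hz' => rw [Completion.coe_add]; exact add _ _ hz hz'

theorem HilbertRep.tensorSpace_ext {F : Type*} [NormedAddCommGroup F] [NormedSpace ℂ F]
    {S T : HilbertRep.tensorSpace p →L[ℂ] F}
    (h : ∀ x y, S (HilbertRep.tensorVec p x y) = T (HilbertRep.tensorVec p x y)) : S = T := by
  ext z
  induction z using HilbertRep.tensorSpace_induction with
  | closed => exact isClosed_eq S.continuous T.continuous
  | vec x y => exact h x y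
  | add z z' hz hz' => rw [map_add, map_add, hz, hz']

theorem HilbertRep.tensorVec_add_left (x x' : p.1.H) (y : p.2.H) :
    HilbertRep.tensorVec p (x + x') y =
      HilbertRep.tensorVec p x y + HilbertRep.tensorVec p x' y := by
  simp [HilbertRep.tensorVec, TensorProduct.add_tmul, Completion.coe_add]

theorem HilbertRep.tensorVec_add_right (x : p.1.H) (y y' : p.2.H) :
    HilbertRep.tensorVec p x (y + y') =
      HilbertRep.tensorVec p x y + HilbertRep.tensorVec p x y' := by
  simp [HilbertRep.tensorVec, TensorProduct.tmul_add, Completion.coe_add]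

theorem HilbertRep.tensorVec_smul_left (c : ℂ) (x : p.1.H) (y : p.2.H) :
    HilbertRep.tensorVec p (c • x) y = c • HilbertRep.tensorVec p x y := by
  simp [HilbertRep.tensorVec, ← TensorProduct.smul_tmul', Completion.coe_smul]

theorem HilbertRep.tensorVec_smul_right (c : ℂ) (x : p.1.H) (y : p.2.H) :
    HilbertRep.tensorVec p x (c • y) = c • HilbertRep.tensorVec p x y := by
  simp [HilbertRep.tensorVec, Completion.coe_smul]

theorem HilbertRep.norm_tensorVec (x : p.1.H) (y : p.2.H) :
    ‖HilbertRep.tensorVec p x y‖ = ‖x‖ * ‖y‖ := by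
  rw [HilbertRep.tensorVec, Completion.norm_coe, TensorProduct.norm_tmul]

theorem HilbertRep.tensorOp_star (a : A) (b : B) :
    HilbertRep.tensorOp p (star a) (star b) = star (HilbertRep.tensorOp p a b) := by
  rw [ContinuousLinearMap.star_eq_adjoint, ContinuousLinearMap.eq_adjoint_iff]
  intro z w
  have hT : ∀ a b, Continuous (HilbertRep.tensorOp p a b) := fun a b =>
    ContinuousLinearMap.continuous _
  induction z using HilbertRep.tensorSpace_induction with
  | closed =>
    exact isClosed_eq (Continuous.inner (𝕜 := ℂ) (hT _ _) continuous_const)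
      (Continuous.inner (𝕜 := ℂ) continuous_id continuous_const)
  | add z z' hz hz' => rw [map_add, inner_add_left, inner_add_left, hz, hz']
  | vec x y =>
    induction w using HilbertRep.tensorSpace_induction with
    | closed =>
      exact isClosed_eq (Continuous.inner (𝕜 := ℂ) continuous_const continuous_id)
        (Continuous.inner (𝕜 := ℂ) continuous_const (hT _ _))
    | add w w' hw hw' => rw [map_add, inner_add_right, inner_add_right, hw, hw']
    | vec x' y' =>
      rw [HilbertRep.tensorOp_tensorVec, HilbertRep.tensorOp_tensorVec,
        HilbertRep.inner_tensorVec, HilbertRep.inner_tensorVec, map_star, map_star,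
        ContinuousLinearMap.star_eq_adjoint, ContinuousLinearMap.star_eq_adjoint,
        ContinuousLinearMap.adjoint_inner_left, ContinuousLinearMap.adjoint_inner_left]

end Operators

variable {A : Type u} {B : Type v} [CStarAlgebra A] [CStarAlgebra B]

variable (A B) in
/-- The ambient product of the minimal tensor product, as an irreducible type with a single
C*-algebra structure: this spares the search for instances on a subtype of a product. -/
def MinTAmbient : Type (max (u + 1) (v + 1)) := MinTensorAmbient A B

variable (A B) in
/-- The minimal tensor product, as an irreducible type with a single C*-algebra structure; see
`MinT.toMinTensor`. -/
def MinT : Type (max (u + 1) (v + 1)) := MinTensor A B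

instance MinTAmbient.instCStarAlgebra : CStarAlgebra (MinTAmbient A B) :=
  MinTensorAmbient.instCStarAlgebra A B

instance MinT.instCStarAlgebra : CStarAlgebra (MinT A B) :=
  StarSubalgebra.cstarAlgebra
    (cstarGenerated (Set.range fun p : A × B => minTensorAmbientTmul p.1 p.2))

/-- The elementary tensor `a ⊗ b`. -/
def MinT.tmul (a : A) (b : B) : MinT A B := (minTmul a b : MinTensor A B)

variable (A B) in
/-- The identity map, from `MinT` to `MinTensor`. -/
def MinT.toMinTensor : MinT A B →⋆ₐ[ℂ] MinTensor A B where
  toFun x := x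
  map_one' := rfl
  map_mul' _ _ := rfl
  map_zero' := rfl
  map_add' _ _ := rfl
  commutes' _ := rfl
  map_star' _ := rfl

variable (A B) in
/-- The identity map, from `MinTensor` to `MinT`. -/
def MinT.ofMinTensor : MinTensor A B →⋆ₐ[ℂ] MinT A B where
  toFun x := x
  map_one' := rfl
  map_mul' _ _ := rfl
  map_zero' := rfl
  map_add' _ _ := rfl
  commutes' _ := rfl
  map_star' _ := rfl

variable (A B) in
/-- The identity map, from `MinTensor` to `MinT`, as a continuous linear map. -/
def MinT.ofMinTensorCLM : MinTensor A B →L[ℂ] MinT A B where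
  toFun x := x
  map_add' _ _ := rfl
  map_smul' _ _ := rfl
  cont := continuous_id

theorem MinT.toMinTensor_sum_tmul {κ : Type*} [Fintype κ] (a : κ → A) (b : κ → B) :
    MinT.toMinTensor A B (∑ m, MinT.tmul (a m) (b m)) = ∑ m, minTmul (a m) (b m) := rfl

variable (A B) in
/-- The inclusion of the minimal tensor product into the product of the algebras `B(H ⊗ H')`. -/
def MinT.incl : MinT A B →⋆ₐ[ℂ] MinTAmbient A B where
  toFun x := x.1
  map_one' := rfl
  map_mul' _ _ := rfl
  map_zero' := rfl
  map_add' _ _ := rfl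
  commutes' _ := rfl
  map_star' _ := rfl

theorem MinT.incl_injective : Function.Injective (MinT.incl A B) := Subtype.val_injective

/-- The representation `π ⊗ ρ` on the product of all the algebras `B(H ⊗ H')`. -/
def MinTAmbient.eval (p : HilbertRep A × HilbertRep B) :
    MinTAmbient A B →⋆ₐ[ℂ] (HilbertRep.tensorSpace p →L[ℂ] HilbertRep.tensorSpace p) where
  toFun x := x.1 p
  map_one' := rfl
  map_mul' _ _ := rfl
  map_zero' := rfl
  map_add' _ _ := rfl
  commutes' _ := rfl
  map_star' _ := rfl

theorem MinTAmbient.ext_eval {x y : MinTAmbient A B}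
    (h : ∀ p, MinTAmbient.eval p x = MinTAmbient.eval p y) : x = y :=
  lp.ext (funext h)

/-- Morphisms into all the algebras `B(H ⊗ H')` define a morphism into their bounded product. -/
theorem MinTAmbient.exists_lift {C : Type*} [CStarAlgebra C]
    (f : ∀ p : HilbertRep A × HilbertRep B,
      C →⋆ₐ[ℂ] (HilbertRep.tensorSpace p →L[ℂ] HilbertRep.tensorSpace p)) :
    ∃ F : C →⋆ₐ[ℂ] MinTAmbient A B, ∀ c p, MinTAmbient.eval p (F c) = f p c := by
  let F : C → MinTAmbient A B := fun c => (⟨fun p => f p c, memℓp_infty ⟨‖c‖, by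
    rintro _ ⟨p, rfl⟩
    exact NonUnitalStarAlgHom.norm_apply_le (f p) c⟩⟩ : MinTensorAmbient A B)
  have hF : ∀ c p, MinTAmbient.eval p (F c) = f p c := fun _ _ => rfl
  refine ⟨{ toFun := F, map_one' := ?_, map_mul' := ?_, map_zero' := ?_, map_add' := ?_,
            commutes' := ?_, map_star' := ?_ }, hF⟩
  · exact MinTAmbient.ext_eval fun p => by rw [hF, map_one, map_one]
  · exact fun a b => MinTAmbient.ext_eval fun p => by rw [map_mul, hF, hF, hF, map_mul]
  · exact MinTAmbient.ext_eval fun p => by rw [hF, map_zero, map_zero]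
  · exact fun a b => MinTAmbient.ext_eval fun p => by rw [map_add, hF, hF, hF, map_add]
  · exact fun c => MinTAmbient.ext_eval fun p => by
      rw [hF, AlgHomClass.commutes, AlgHomClass.commutes]
  · exact fun a => MinTAmbient.ext_eval fun p => by rw [map_star, hF, hF, map_star]

variable (A B) in
theorem MinT.cstarGenerated_range_tmul :
    cstarGenerated (Set.range fun p : A × B => (MinT.tmul p.1 p.2 : MinT A B)) = ⊤ := by
  have h : cstarGenerated (Set.range fun p : A × B => minTensorAmbientTmul p.1 p.2) ≤
      cstarGenerated (Subtype.val '' (Set.range fun p : A × B => (minTmul p.1 p.2))) := by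
    refine le_of_eq (congrArg _ ?_)
    rw [← Set.range_comp]
    rfl
  exact cstarGenerated_eq_top_of_le h

attribute [irreducible] MinT.instCStarAlgebra MinTAmbient.instCStarAlgebra

namespace MinT

/-- The representation `π ⊗ ρ` of the minimal tensor product. -/
def eval (p : HilbertRep A × HilbertRep B) :
    MinT A B →⋆ₐ[ℂ] (HilbertRep.tensorSpace p →L[ℂ] HilbertRep.tensorSpace p) :=
  (MinTAmbient.eval p).comp (MinT.incl A B)

theorem eval_tmul (p : HilbertRep A × HilbertRep B) (a : A) (b : B) :
    MinT.eval p (MinT.tmul a b) = HilbertRep.tensorOp p a b := rfl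

theorem ext_eval {x y : MinT A B} (h : ∀ p, MinT.eval p x = MinT.eval p y) : x = y :=
  MinT.incl_injective (MinTAmbient.ext_eval h)

theorem eval_tmul_tensorVec (p : HilbertRep A × HilbertRep B) (a : A) (b : B) (x : p.1.H)
    (y : p.2.H) : MinT.eval p (MinT.tmul a b) (HilbertRep.tensorVec p x y) =
      HilbertRep.tensorVec p (p.1.rep a x) (p.2.rep b y) := by
  rw [eval_tmul, HilbertRep.tensorOp_tensorVec]

theorem tmul_mul (a a' : A) (b b' : B) :
    tmul (a * a') (b * b') = tmul a b * tmul a' b' := by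
  refine ext_eval fun p => HilbertRep.tensorSpace_ext p fun x y => ?_
  simp [eval_tmul_tensorVec]

theorem tmul_one : tmul (1 : A) (1 : B) = 1 := by
  refine ext_eval fun p => HilbertRep.tensorSpace_ext p fun x y => ?_
  simp [eval_tmul_tensorVec]

theorem tmul_star (a : A) (b : B) : tmul (star a) (star b) = star (tmul a b) := by
  refine ext_eval fun p => ?_
  rw [map_star, eval_tmul, eval_tmul, HilbertRep.tensorOp_star]

theorem tmul_add_left (a a' : A) (b : B) :
    tmul (a + a') b = tmul a b + tmul a' b := by
  refine ext_eval fun p => HilbertRep.tensorSpace_ext p fun x y => ?_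
  simp [eval_tmul_tensorVec, HilbertRep.tensorVec_add_left]

theorem tmul_add_right (a : A) (b b' : B) :
    tmul a (b + b') = tmul a b + tmul a b' := by
  refine ext_eval fun p => HilbertRep.tensorSpace_ext p fun x y => ?_
  simp [eval_tmul_tensorVec, HilbertRep.tensorVec_add_right]

theorem tmul_smul_left (c : ℂ) (a : A) (b : B) : tmul (c • a) b = c • tmul a b := by
  refine ext_eval fun p => HilbertRep.tensorSpace_ext p fun x y => ?_
  simp [eval_tmul_tensorVec, HilbertRep.tensorVec_smul_left]

theorem tmul_smul_right (c : ℂ) (a : A) (b : B) : tmul a (c • b) = c • tmul a b := by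
  refine ext_eval fun p => HilbertRep.tensorSpace_ext p fun x y => ?_
  simp [eval_tmul_tensorVec, HilbertRep.tensorVec_smul_right]

theorem tmul_pow (a : A) (b : B) (n : ℕ) : tmul a b ^ n = tmul (a ^ n) (b ^ n) := by
  induction n with
  | zero => simp [tmul_one]
  | succ n ih => rw [pow_succ, pow_succ, pow_succ, tmul_mul, ih]

theorem tmul_zero_left (b : B) : tmul (0 : A) b = 0 := by
  simpa using tmul_smul_left 0 (0 : A) b

/-- The morphism `a ↦ a ⊗ 1`. -/
def inl : A →⋆ₐ[ℂ] MinT A B where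
  toFun a := tmul a 1
  map_one' := tmul_one
  map_mul' a a' := by rw [← tmul_mul, one_mul]
  map_zero' := tmul_zero_left 1
  map_add' a a' := tmul_add_left a a' 1
  commutes' c := by
    rw [Algebra.algebraMap_eq_smul_one, tmul_smul_left, tmul_one,
      Algebra.algebraMap_eq_smul_one]
  map_star' a := by rw [← tmul_star, star_one]

/-- The morphism `b ↦ 1 ⊗ b`. -/
def inr : B →⋆ₐ[ℂ] MinT A B where
  toFun b := tmul 1 b
  map_one' := tmul_one
  map_mul' a a' := by rw [← tmul_mul, one_mul]
  map_zero' := by simpa using tmul_smul_right 0 (1 : A) (0 : B)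
  map_add' a a' := tmul_add_right 1 a a'
  commutes' c := by
    rw [Algebra.algebraMap_eq_smul_one, tmul_smul_right, tmul_one,
      Algebra.algebraMap_eq_smul_one]
  map_star' a := by rw [← tmul_star, star_one]

/-- Elementary tensors are total in the minimal tensor product. -/
theorem induction {P : MinT A B → Prop} (closed : IsClosed {x | P x})
    (tmul : ∀ a b, P (tmul a b)) (add : ∀ x y, P x → P y → P (x + y)) (x : MinT A B) : P x := by
  refine closure_minimal (fun y hy => ?_) closed
    (mem_closure_span_of_cstarGenerated (cstarGenerated_range_tmul A B) ⟨(1, 1), tmul_one⟩ ?_ ?_ x)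
  rotate_left
  · rintro _ ⟨p, rfl⟩ _ ⟨q, rfl⟩
    exact ⟨(p.1 * q.1, p.2 * q.2), tmul_mul _ _ _ _⟩
  · rintro _ ⟨p, rfl⟩
    exact ⟨(star p.1, star p.2), tmul_star _ _⟩
  change P y
  -- the span is the additive closure, as multiples of elementary tensors are elementary tensors
  refine Submodule.closure_induction (p := fun y _ => P y) ?_ (fun y z _ _ => add y z) ?_ hy
  · simpa [tmul_zero_left] using tmul 0 0
  · rintro c _ ⟨p, rfl⟩
    simp only [← tmul_smul_left]
    exact tmul _ _

theorem clm_ext {F : Type*} [NormedAddCommGroup F] [NormedSpace ℂ F] {S T : MinT A B →L[ℂ] F}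
    (h : ∀ a b, S (tmul a b) = T (tmul a b)) : S = T := by
  ext x
  induction x using MinT.induction with
  | closed => exact isClosed_eq S.continuous T.continuous
  | tmul a b => exact h a b
  | add x y hx hy => rw [map_add, map_add, hx, hy]

end MinT

end MinTensorAlgebra

/-! ### Slice maps, and functoriality of the minimal tensor product -/

noncomputable section Slices

open scoped CStarAlgebra InnerProductSpace

/-- A bounded operator with values in the image of a C*-algebra factors through it. -/
theorem ContinuousLinearMap.exists_lift_of_injective {X B E : Type*} [NormedAddCommGroup X]
    [NormedSpace ℂ X] [CStarAlgebra B] [CStarAlgebra E] (T : X →L[ℂ] E) (j : B →⋆ₐ[ℂ] E)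
    (hj : Function.Injective j) (h : ∀ x, T x ∈ Set.range j) :
    ∃ R : X →L[ℂ] B, ∀ x, j (R x) = T x := by
  let J : B →ₗᵢ[ℂ] E :=
    { toLinearMap := j.toAlgHom.toLinearMap, norm_map' := NonUnitalStarAlgHom.norm_map j hj }
  refine ⟨(J.equivRange.symm.toContinuousLinearEquiv : _ →L[ℂ] B).comp
    (T.codRestrict (LinearMap.range J.toLinearMap) h), fun x => ?_⟩
  exact congrArg Subtype.val (J.equivRange.apply_symm_apply
    (T.codRestrict (LinearMap.range J.toLinearMap) h x))

section Compressions

variable {A : Type u} {B : Type v} [CStarAlgebra A] [CStarAlgebra B]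
  (p : HilbertRep A × HilbertRep B)

/-- The operator `y ↦ x ⊗ y`. -/
def HilbertRep.tensorVecLeft (x : p.1.H) : p.2.H →L[ℂ] HilbertRep.tensorSpace p :=
  LinearMap.mkContinuous
    { toFun := fun y => HilbertRep.tensorVec p x y
      map_add' := HilbertRep.tensorVec_add_right p x
      map_smul' := fun c y => HilbertRep.tensorVec_smul_right p c x y }
    ‖x‖ fun y => (HilbertRep.norm_tensorVec p x y).le

/-- The operator `x ↦ x ⊗ y`. -/
def HilbertRep.tensorVecRight (y : p.2.H) : p.1.H →L[ℂ] HilbertRep.tensorSpace p :=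
  LinearMap.mkContinuous
    { toFun := fun x => HilbertRep.tensorVec p x y
      map_add' := fun x x' => HilbertRep.tensorVec_add_left p x x' y
      map_smul' := fun c x => HilbertRep.tensorVec_smul_left p c x y }
    ‖y‖ fun x => (HilbertRep.norm_tensorVec p x y).le.trans (mul_comm _ _).le

/-- Two-sided multiplication `T ↦ V^* T W`. -/
def compress {H K : Type*} [NormedAddCommGroup H] [InnerProductSpace ℂ H] [CompleteSpace H]
    [NormedAddCommGroup K] [InnerProductSpace ℂ K] [CompleteSpace K] (V W : H →L[ℂ] K) :
    (K →L[ℂ] K) →L[ℂ] (H →L[ℂ] H) :=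
  (ContinuousLinearMap.compL ℂ H K H (ContinuousLinearMap.adjoint V)).comp
    ((ContinuousLinearMap.compL ℂ H K K).flip W)

theorem inner_compress {H K : Type*} [NormedAddCommGroup H] [InnerProductSpace ℂ H]
    [CompleteSpace H] [NormedAddCommGroup K] [InnerProductSpace ℂ K] [CompleteSpace K]
    (V W : H →L[ℂ] K) (T : K →L[ℂ] K) (x y : H) :
    ⟪x, compress V W T y⟫_ℂ = ⟪V x, T (W y)⟫_ℂ := by
  simp [compress, ContinuousLinearMap.adjoint_inner_right]

namespace MinT

/-- The operator `(ω_{e,f} ⊗ id)((π ⊗ ρ)(x))` on the space of `ρ`. -/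
def leftCompress (e f : p.1.H) : MinT A B →L[ℂ] (p.2.H →L[ℂ] p.2.H) :=
  (compress (HilbertRep.tensorVecLeft p e) (HilbertRep.tensorVecLeft p f)).comp
    (MinT.eval p).toCLM

/-- The operator `(id ⊗ ω_{e,f})((π ⊗ ρ)(x))` on the space of `π`. -/
def rightCompress (e f : p.2.H) : MinT A B →L[ℂ] (p.1.H →L[ℂ] p.1.H) :=
  (compress (HilbertRep.tensorVecRight p e) (HilbertRep.tensorVecRight p f)).comp
    (MinT.eval p).toCLM

theorem inner_leftCompress (e f : p.1.H) (x : MinT A B) (y y' : p.2.H) :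
    ⟪y, leftCompress p e f x y'⟫_ℂ =
      ⟪HilbertRep.tensorVec p e y, MinT.eval p x (HilbertRep.tensorVec p f y')⟫_ℂ :=
  inner_compress _ _ _ _ _

theorem inner_rightCompress (e f : p.2.H) (x : MinT A B) (y y' : p.1.H) :
    ⟪y, rightCompress p e f x y'⟫_ℂ =
      ⟪HilbertRep.tensorVec p y e, MinT.eval p x (HilbertRep.tensorVec p y' f)⟫_ℂ :=
  inner_compress _ _ _ _ _

theorem leftCompress_tmul (e f : p.1.H) (a : A) (b : B) :
    leftCompress p e f (tmul a b) = ⟪e, p.1.rep a f⟫_ℂ • p.2.rep b := by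
  refine ContinuousLinearMap.ext fun y' => ext_inner_left ℂ fun y => ?_
  rw [inner_leftCompress, eval_tmul_tensorVec, HilbertRep.inner_tensorVec,
    _root_.smul_apply, inner_smul_right]

theorem rightCompress_tmul (e f : p.2.H) (a : A) (b : B) :
    rightCompress p e f (tmul a b) = ⟪e, p.2.rep b f⟫_ℂ • p.1.rep a := by
  refine ContinuousLinearMap.ext fun y' => ext_inner_left ℂ fun y => ?_
  rw [inner_rightCompress, eval_tmul_tensorVec, HilbertRep.inner_tensorVec,
    _root_.smul_apply, inner_smul_right, mul_comm]

end MinT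

end Compressions

namespace MinT

variable {A : Type u} {B : Type v} [CStarAlgebra A] [CStarAlgebra B]

/-- The slice map `ω_{e,f} ⊗ id`, given by a vector functional of a representation of the first
factor. It takes values in the second factor as soon as this has a faithful representation. -/
theorem exists_leftSlice (ρ₀ : HilbertRep B) (hρ₀ : Function.Injective ρ₀.rep)
    (π : HilbertRep A) (e f : π.H) :
    ∃ R : MinT A B →L[ℂ] B, (∀ a b, R (tmul a b) = ⟪e, π.rep a f⟫_ℂ • b) ∧
      ∀ (ρ : HilbertRep B) x, ρ.rep (R x) = leftCompress (π, ρ) e f x := by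
  obtain ⟨R, hR⟩ := (leftCompress (π, ρ₀) e f).exists_lift_of_injective ρ₀.rep hρ₀ fun x => by
    induction x using MinT.induction with
    | closed =>
      exact (StarAlgHom.isClosed_range ρ₀.rep).preimage (leftCompress (π, ρ₀) e f).continuous
    | tmul a b =>
      exact ⟨⟪e, π.rep a f⟫_ℂ • b, by rw [leftCompress_tmul, map_smul]⟩
    | add x y hx hy =>
      obtain ⟨c, hc⟩ := hx
      obtain ⟨d, hd⟩ := hy
      exact ⟨c + d, by rw [map_add, map_add, hc, hd]⟩
  have htmul : ∀ a b, R (tmul a b) = ⟪e, π.rep a f⟫_ℂ • b := fun a b =>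
    hρ₀ (by rw [hR, leftCompress_tmul, map_smul])
  refine ⟨R, htmul, fun ρ x => ?_⟩
  induction x using MinT.induction with
  | closed =>
    exact isClosed_eq ((map_continuous ρ.rep).comp R.continuous)
      (leftCompress (π, ρ) e f).continuous
  | tmul a b => rw [htmul, leftCompress_tmul, map_smul]
  | add x y hx hy => rw [map_add, map_add, map_add, hx, hy]

/-- The slice map `id ⊗ ω_{e,f}`. -/
theorem exists_rightSlice (π₀ : HilbertRep A) (hπ₀ : Function.Injective π₀.rep)
    (ρ : HilbertRep B) (e f : ρ.H) :
    ∃ R : MinT A B →L[ℂ] A, (∀ a b, R (tmul a b) = ⟪e, ρ.rep b f⟫_ℂ • a) ∧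
      ∀ (π : HilbertRep A) x, π.rep (R x) = rightCompress (π, ρ) e f x := by
  obtain ⟨R, hR⟩ := (rightCompress (π₀, ρ) e f).exists_lift_of_injective π₀.rep hπ₀ fun x => by
    induction x using MinT.induction with
    | closed =>
      exact (StarAlgHom.isClosed_range π₀.rep).preimage (rightCompress (π₀, ρ) e f).continuous
    | tmul a b =>
      exact ⟨⟪e, ρ.rep b f⟫_ℂ • a, by rw [rightCompress_tmul, map_smul]⟩
    | add x y hx hy =>
      obtain ⟨c, hc⟩ := hx
      obtain ⟨d, hd⟩ := hy
      exact ⟨c + d, by rw [map_add, map_add, hc, hd]⟩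
  have htmul : ∀ a b, R (tmul a b) = ⟪e, ρ.rep b f⟫_ℂ • a := fun a b =>
    hπ₀ (by rw [hR, rightCompress_tmul, map_smul])
  refine ⟨R, htmul, fun π x => ?_⟩
  induction x using MinT.induction with
  | closed =>
    exact isClosed_eq ((map_continuous π.rep).comp R.continuous)
      (rightCompress (π, ρ) e f).continuous
  | tmul a b => rw [htmul, rightCompress_tmul, map_smul]
  | add x y hx hy => rw [map_add, map_add, map_add, hx, hy]

/-- The minimal tensor product is represented faithfully by the tensor product of any two faithful
representations: the slices of `x` are determined by those seen in the faithful pair. -/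
theorem eq_zero_of_eval_eq_zero {π₀ : HilbertRep A} (hπ₀ : Function.Injective π₀.rep)
    {ρ₀ : HilbertRep B} (hρ₀ : Function.Injective ρ₀.rep) {x : MinT A B}
    (hx : MinT.eval (π₀, ρ₀) x = 0) : x = 0 := by
  have h1 : ∀ ρ : HilbertRep B, MinT.eval (π₀, ρ) x = 0 := fun ρ => by
    refine HilbertRep.tensorSpace_ext (π₀, ρ) fun f y' => ?_
    refine ext_inner_left ℂ fun z => ?_
    rw [_root_.zero_apply, inner_zero_right]
    induction z using HilbertRep.tensorSpace_induction with
    | closed =>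
      exact isClosed_eq (Continuous.inner (𝕜 := ℂ) continuous_id continuous_const)
        continuous_const
    | add z z' hz hz' => rw [inner_add_left, hz, hz', add_zero]
    | vec e y =>
      obtain ⟨R, -, hR⟩ := exists_leftSlice ρ₀ hρ₀ π₀ e f
      have h0 : R x = 0 := by
        refine hρ₀ ?_
        rw [hR, map_zero]
        refine ContinuousLinearMap.ext fun w' => ext_inner_left ℂ fun w => ?_
        rw [inner_leftCompress, hx]
        simp
      rw [← inner_leftCompress (π₀, ρ), ← hR, h0, map_zero]
      simp
  refine ext_eval fun p => ?_
  obtain ⟨π, ρ⟩ := p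
  rw [map_zero]
  refine HilbertRep.tensorSpace_ext (π, ρ) fun x' f => ?_
  refine ext_inner_left ℂ fun z => ?_
  rw [_root_.zero_apply, inner_zero_right]
  induction z using HilbertRep.tensorSpace_induction with
  | closed =>
    exact isClosed_eq (Continuous.inner (𝕜 := ℂ) continuous_id continuous_const)
      continuous_const
  | add z z' hz hz' => rw [inner_add_left, hz, hz', add_zero]
  | vec y e =>
    obtain ⟨R, -, hR⟩ := exists_rightSlice π₀ hπ₀ ρ e f
    have h0 : R x = 0 := by
      refine hπ₀ ?_
      rw [hR, map_zero]
      refine ContinuousLinearMap.ext fun w' => ext_inner_left ℂ fun w => ?_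
      rw [inner_rightCompress, h1 ρ]
      simp
    rw [← inner_rightCompress (π, ρ), ← hR, h0, map_zero]
    simp

end MinT

/-- The restriction of a representation along a morphism. -/
def HilbertRep.comap {A D : Type u} [CStarAlgebra A] [CStarAlgebra D] (ι : A →⋆ₐ[ℂ] D)
    (π : HilbertRep D) : HilbertRep A where
  H := π.H
  rep := π.rep.comp ι

section Comap

variable {A D : Type u} {B E : Type v} [CStarAlgebra A] [CStarAlgebra B] [CStarAlgebra D]
  [CStarAlgebra E] (ι : A →⋆ₐ[ℂ] D) (κ : B →⋆ₐ[ℂ] E) (p : HilbertRep D × HilbertRep E)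

/-- The representation `πι ⊗ ρκ`, on the space of `π ⊗ ρ`. -/
def MinT.evalComap :
    MinT A B →⋆ₐ[ℂ] (HilbertRep.tensorSpace p →L[ℂ] HilbertRep.tensorSpace p) :=
  MinT.eval (p.1.comap ι, p.2.comap κ)

theorem MinT.evalComap_tmul (a : A) (b : B) :
    MinT.evalComap ι κ p (MinT.tmul a b) = MinT.eval p (MinT.tmul (ι a) (κ b)) :=
  (MinT.eval_tmul (p.1.comap ι, p.2.comap κ) a b).trans (MinT.eval_tmul p (ι a) (κ b)).symm

end Comap

/-- Injective morphisms `ι`, `κ` induce an injective morphism `ι ⊗ κ` of minimal tensor products,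
provided that the targets have faithful representations. -/
theorem MinT.exists_map_injective {A D : Type u} {B E : Type v} [CStarAlgebra A] [CStarAlgebra B]
    [CStarAlgebra D] [CStarAlgebra E] (ι : A →⋆ₐ[ℂ] D) (κ : B →⋆ₐ[ℂ] E)
    (hι : Function.Injective ι) (hκ : Function.Injective κ)
    (π₀ : HilbertRep D) (hπ₀ : Function.Injective π₀.rep)
    (ρ₀ : HilbertRep E) (hρ₀ : Function.Injective ρ₀.rep) :
    ∃ J : MinT A B →⋆ₐ[ℂ] MinT D E,
      Function.Injective J ∧ ∀ a b, J (MinT.tmul a b) = MinT.tmul (ι a) (κ b) := by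
  obtain ⟨F, hF⟩ := MinTAmbient.exists_lift (A := D) (B := E) (MinT.evalComap ι κ)
  have hF' : ∀ a b, F (MinT.tmul a b) = MinT.incl D E (MinT.tmul (ι a) (κ b)) := fun a b =>
    MinTAmbient.ext_eval fun p => (hF _ p).trans (MinT.evalComap_tmul ι κ p a b)
  obtain ⟨J, hJ⟩ := F.exists_lift_of_injective (MinT.cstarGenerated_range_tmul A B)
    (MinT.incl D E) MinT.incl_injective (by
      rintro _ ⟨p, rfl⟩
      exact ⟨_, (hF' _ _).symm⟩)
  refine ⟨J, (injective_iff_map_eq_zero J).2 fun x hx => ?_, fun a b => ?_⟩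
  · refine MinT.eq_zero_of_eval_eq_zero (π₀ := π₀.comap ι) (hπ₀.comp hι) (ρ₀ := ρ₀.comap κ)
      (hρ₀.comp hκ) ?_
    have := hF x (π₀, ρ₀)
    rw [← hJ, hx, map_zero, map_zero] at this
    exact this.symm
  · exact MinT.incl_injective (by rw [hJ, hF'])

end Slices

/-! ### Commuting morphisms out of algebras of continuous functions -/

noncomputable section CommutingMorphisms

open scoped CStarAlgebra

variable {X Y : Type*} [TopologicalSpace X] [TopologicalSpace Y]

variable [CompactSpace X] [CompactSpace Y] [T2Space X] [T2Space Y]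

/-- By the Stone–Weierstrass theorem, the functions `a(x) b(y)` are total in `C(X × Y)`. -/
theorem ContinuousMap.clm_ext_prod {F : Type*} [NormedAddCommGroup F] [NormedSpace ℂ F]
    {S T : C(X × Y, ℂ) →L[ℂ] F}
    (h : ∀ (a : C(X, ℂ)) (b : C(Y, ℂ)), S (a.prodMul b) = T (a.prodMul b)) : S = T := by
  let G : Set C(X × Y, ℂ) := Set.range fun p : C(X, ℂ) × C(Y, ℂ) => p.1.prodMul p.2
  have hG : cstarGenerated G = ⊤ := by
    refine ContinuousMap.starSubalgebra_topologicalClosure_eq_top_of_separatesPoints _ ?_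
    rintro ⟨x, y⟩ ⟨x', y'⟩ hne
    have hne' : x ≠ x' ∨ y ≠ y' := by
      by_contra! hh
      exact hne (Prod.ext hh.1 hh.2)
    rcases hne' with hx | hy
    · obtain ⟨f, hf⟩ := (WeakDual.CharacterSpace.continuousMapEval_bijective X ℂ).1.ne hx |>
        DFunLike.ne_iff.1
      refine ⟨_, ⟨f.prodMul 1, StarAlgebra.subset_adjoin ℂ _ ⟨(f, 1), rfl⟩, rfl⟩, ?_⟩
      simpa using hf
    · obtain ⟨f, hf⟩ := (WeakDual.CharacterSpace.continuousMapEval_bijective Y ℂ).1.ne hy |>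
        DFunLike.ne_iff.1
      refine ⟨_, ⟨(1 : C(X, ℂ)).prodMul f, StarAlgebra.subset_adjoin ℂ _ ⟨(1, f), rfl⟩, rfl⟩, ?_⟩
      simpa using hf
  have hd := mem_closure_span_of_cstarGenerated hG ⟨(1, 1), by ext p; simp [prodMul]⟩
    (by
      rintro _ ⟨p, rfl⟩ _ ⟨q, rfl⟩
      exact ⟨(p.1 * q.1, p.2 * q.2), by ext z; simp [mul_mul_mul_comm]⟩)
    (by
      rintro _ ⟨p, rfl⟩
      exact ⟨(star p.1, star p.2), by ext z; simp⟩)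
  refine ContinuousLinearMap.ext_on (dense_iff_closure_eq.2 (Set.eq_univ_of_forall hd)) ?_
  rintro _ ⟨p, rfl⟩
  exact h _ _

/-- The C*-algebra generated by a set of commuting elements closed under adjoints is
commutative. -/
theorem commute_of_mem_cstarGenerated {E : Type*} [CStarAlgebra E] {S : Set E}
    (hS : ∀ x ∈ S, ∀ y ∈ S, Commute x y) (hstar : ∀ x ∈ S, star x ∈ S) {x y : E}
    (hx : x ∈ cstarGenerated S) (hy : y ∈ cstarGenerated S) : Commute x y := by
  have key : ∀ T : Set E, (∀ x ∈ S, ∀ y ∈ T, Commute y x) → ∀ x ∈ cstarGenerated S,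
      ∀ y ∈ T, (∀ z ∈ T, star z ∈ T) → Commute y x := by
    intro T hT x hx y hy hTs
    have : cstarGenerated S ≤ StarSubalgebra.centralizer ℂ T :=
      cstarGenerated_le (by
        rw [StarSubalgebra.coe_centralizer]
        exact Set.isClosed_centralizer _) fun x hx => by
        rw [SetLike.mem_coe, StarSubalgebra.mem_centralizer_iff]
        exact fun z hz => ⟨hT x hx z hz, hT x hx _ (hTs z hz)⟩
    exact ((StarSubalgebra.mem_centralizer_iff ℂ).1 (this hx) y hy).1
  refine (key (cstarGenerated S) (fun x' hx' y' hy' => ?_) x hx y hy fun z hz =>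
    star_mem hz).symm
  exact (key S (fun a ha b hb => hS b hb a ha) y' hy' x' hx' hstar).symm

/-- Two commuting morphisms `φ : C(X) → E`, `ψ : C(Y) → E` factor through `C(X × Y)`: the
C*-algebra they generate is commutative, thus of the form `C(Z)`, and `φ`, `ψ` correspond to two
maps `Z → X`, `Z → Y`. -/
theorem ContinuousMap.exists_starAlgHom_prod {E : Type*} [CStarAlgebra E]
    (φ : C(X, ℂ) →⋆ₐ[ℂ] E) (ψ : C(Y, ℂ) →⋆ₐ[ℂ] E) (hc : ∀ a b, Commute (φ a) (ψ b)) :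
    ∃ T : C(X × Y, ℂ) →⋆ₐ[ℂ] E, ∀ a b, T (a.prodMul b) = φ a * ψ b := by
  let S : Set E := Set.range φ ∪ Set.range ψ
  have hcomm : ∀ x y : cstarGenerated S, x * y = y * x := by
    rintro ⟨x, hx⟩ ⟨y, hy⟩
    refine Subtype.ext (commute_of_mem_cstarGenerated (S := S) ?_ ?_ hx hy)
    · rintro _ (⟨a, rfl⟩ | ⟨a, rfl⟩) _ (⟨b, rfl⟩ | ⟨b, rfl⟩)
      · exact (Commute.all a b).map φ
      · exact hc a b
      · exact (hc b a).symm
      · exact (Commute.all a b).map ψ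
    · rintro _ (⟨a, rfl⟩ | ⟨a, rfl⟩)
      · exact Or.inl ⟨star a, map_star φ a⟩
      · exact Or.inr ⟨star a, map_star ψ a⟩
  let _ : CommCStarAlgebra (cstarGenerated S) :=
    { (inferInstance : CStarAlgebra (cstarGenerated S)) with mul_comm := hcomm }
  let φ' : C(X, ℂ) →⋆ₐ[ℂ] cstarGenerated S :=
    φ.codRestrict _ fun a => mem_cstarGenerated (Or.inl ⟨a, rfl⟩)
  let ψ' : C(Y, ℂ) →⋆ₐ[ℂ] cstarGenerated S :=
    ψ.codRestrict _ fun a => mem_cstarGenerated (Or.inr ⟨a, rfl⟩)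
  let Z := WeakDual.characterSpace ℂ (cstarGenerated S)
  let α : C(Z, X) := ((WeakDual.CharacterSpace.homeoEval X ℂ).symm : C(_, _)).comp
    (WeakDual.CharacterSpace.compContinuousMap φ')
  let β : C(Z, Y) := ((WeakDual.CharacterSpace.homeoEval Y ℂ).symm : C(_, _)).comp
    (WeakDual.CharacterSpace.compContinuousMap ψ')
  have hα : ∀ (χ : Z) (a : C(X, ℂ)), a (α χ) = χ (φ' a) := fun χ a => by
    have := (WeakDual.CharacterSpace.homeoEval X ℂ).apply_symm_apply
      (WeakDual.CharacterSpace.compContinuousMap φ' χ)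
    exact DFunLike.congr_fun this a
  have hβ : ∀ (χ : Z) (a : C(Y, ℂ)), a (β χ) = χ (ψ' a) := fun χ a => by
    have := (WeakDual.CharacterSpace.homeoEval Y ℂ).apply_symm_apply
      (WeakDual.CharacterSpace.compContinuousMap ψ' χ)
    exact DFunLike.congr_fun this a
  let T' : C(X × Y, ℂ) →⋆ₐ[ℂ] cstarGenerated S :=
    ((gelfandStarTransform (cstarGenerated S)).symm : _ →⋆ₐ[ℂ] _).comp
      ((α.prodMk β).compStarAlgHom' ℂ ℂ)
  refine ⟨(cstarGenerated S).subtype.comp T', fun a b => ?_⟩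
  have : T' (a.prodMul b) = φ' a * ψ' b := by
    refine (gelfandStarTransform (cstarGenerated S)).injective ?_
    refine ((gelfandStarTransform (cstarGenerated S)).apply_symm_apply _).trans ?_
    ext χ
    change a (α χ) * b (β χ) = χ (φ' a * ψ' b)
    rw [hα, hβ, map_mul]
  exact congrArg Subtype.val this

end CommutingMorphisms

/-! ### Covariant pairs and the crossed product by a cyclic group -/

noncomputable section CrossedProducts

open scoped CStarAlgebra

variable {L : Type*} [Group L] [TopologicalSpace L]

/-- The function `f ∘ σ^n`. -/
def iterPull (σ : L ≃ₜ* L) (n : ℕ) (f : C(L, ℂ)) : C(L, ℂ) where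
  toFun g := f (σ^[n] g)
  continuous_toFun := f.continuous.comp (σ.continuous.iterate n)

theorem iterPull_apply (σ : L ≃ₜ* L) (n : ℕ) (f : C(L, ℂ)) (g : L) :
    iterPull σ n f g = f (σ^[n] g) := rfl

theorem iterPull_symm_iterPull (σ : L ≃ₜ* L) (n : ℕ) (f : C(L, ℂ)) :
    iterPull σ.symm n (iterPull σ n f) = f := by
  ext g
  rw [iterPull_apply, iterPull_apply]
  exact congrArg f (Function.LeftInverse.iterate σ.apply_symm_apply n g)

theorem iterPull_comp_symm (σ : L ≃ₜ* L) (n : ℕ) (f : C(L, ℂ)) :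
    iterPull σ.symm n (f.comp (σ.symm : C(L, L))) = iterPull σ.symm (n + 1) f := by
  ext g
  change f (σ.symm (σ.symm^[n] g)) = f (σ.symm^[n + 1] g)
  rw [Function.iterate_succ_apply']

/-- The conditions of `CovariantPair`, for a morphism `φ` and an element `t` of a C*-algebra in an
arbitrary universe. -/
structure IsCovariant (σ : L ≃ₜ* L) (K : ℕ) {B : Type*} [CStarAlgebra B]
    (φ : C(L, ℂ) →⋆ₐ[ℂ] B) (t : B) : Prop where
  isUnitary : t ∈ unitary B
  pow_eq : t ^ K = 1
  covariant : ∀ f : C(L, ℂ), t * φ f * star t = φ (f.comp (σ.symm : C(L, L)))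

namespace IsCovariant

variable {σ : L ≃ₜ* L} {K : ℕ} {B : Type*} [CStarAlgebra B] {φ : C(L, ℂ) →⋆ₐ[ℂ] B} {t : B}

theorem gen_mul (h : IsCovariant σ K φ t) (f : C(L, ℂ)) :
    t * φ f = φ (f.comp (σ.symm : C(L, L))) * t := by
  rw [← h.covariant, mul_assoc, (Unitary.mem_iff.1 h.isUnitary).1, mul_one]

theorem pow_mul (h : IsCovariant σ K φ t) (n : ℕ) (f : C(L, ℂ)) :
    t ^ n * φ f = φ (iterPull σ.symm n f) * t ^ n := by
  induction n generalizing f with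
  | zero => rw [pow_zero, one_mul, mul_one]; rfl
  | succ n ih => rw [pow_succ, mul_assoc, h.gen_mul, ← mul_assoc, ih, mul_assoc, iterPull_comp_symm]

theorem pow_mod (h : IsCovariant σ K φ t) (n : ℕ) : t ^ (n % K) = t ^ n := by
  conv_rhs => rw [← Nat.mod_add_div n K, pow_add, _root_.pow_mul, h.pow_eq, one_pow, mul_one]

theorem star_pow (h : IsCovariant σ K φ t) (hK : K ≠ 0) (n : ℕ) :
    star (t ^ n) = t ^ ((K - 1) * n) := by
  have h1 : star t = t ^ (K - 1) := by
    calc star t = star t * t ^ (K - 1 + 1) := by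
          rw [Nat.sub_add_cancel (Nat.pos_of_ne_zero hK), h.pow_eq, mul_one]
      _ = t ^ (K - 1) := by
          rw [pow_succ', ← mul_assoc, (Unitary.mem_iff.1 h.isUnitary).1, one_mul]
  rw [_root_.star_pow, h1, _root_.pow_mul]

theorem mul_mul (h : IsCovariant σ K φ t) (f g : C(L, ℂ)) (m n : ℕ) :
    (φ f * t ^ m) * (φ g * t ^ n) = φ (f * iterPull σ.symm m g) * t ^ (m + n) := by
  rw [map_mul, pow_add, mul_assoc, ← mul_assoc (t ^ m), h.pow_mul]
  simp only [mul_assoc]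

theorem star_mul (h : IsCovariant σ K φ t) (hK : K ≠ 0) (f : C(L, ℂ)) (n : ℕ) :
    star (φ f * t ^ n) =
      φ (iterPull σ.symm ((K - 1) * n) (star f)) * t ^ ((K - 1) * n) := by
  rw [StarMul.star_mul, h.star_pow hK, ← map_star, h.pow_mul]

end IsCovariant

/-- A covariant pair `(φ, t)` generating the C*-algebra `D` presents it as the crossed product
`C(L) ⋊ ℤ_K` as soon as the coefficients `f_i` of an element `∑ f_i t^i` are well defined and
depend continuously on it. -/
structure IsCrossedProduct (σ : L ≃ₜ* L) (K : ℕ) {D : Type*} [CStarAlgebra D]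
    (φ : C(L, ℂ) →⋆ₐ[ℂ] D) (t : D) : Prop extends IsCovariant σ K φ t where
  generates : cstarGenerated (Set.range φ ∪ {t}) = ⊤
  coeff : ∃ R : D →L[ℂ] (Fin K → C(L, ℂ)),
    ∀ f n i, R (φ f * t ^ n) i = if (i : ℕ) = n % K then f else 0

section RegularDefs

variable (σ : L ≃ₜ* L) (K : ℕ)

/-- The morphism `f ↦ diag(f ∘ σ, f ∘ σ², …, f ∘ σ^K)`. -/
def regularFun : C(L, ℂ) →⋆ₐ[ℂ] CStarMatrix (Fin K) (Fin K) C(L, ℂ) where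
  toFun f := CStarMatrix.ofMatrix
    (Matrix.diagonal fun r : Fin K => iterPull σ ((r : ℕ) + 1) f)
  map_one' := Matrix.diagonal_one
  map_mul' f g := (Matrix.diagonal_mul_diagonal (fun r : Fin K => iterPull σ ((r : ℕ) + 1) f)
    fun r : Fin K => iterPull σ ((r : ℕ) + 1) g).symm
  map_zero' := Matrix.diagonal_zero
  map_add' f g := (Matrix.diagonal_add (fun r : Fin K => iterPull σ ((r : ℕ) + 1) f)
    fun r : Fin K => iterPull σ ((r : ℕ) + 1) g).symm
  commutes' _ := rfl
  map_star' f := (Matrix.diagonal_conjTranspose fun r : Fin K => iterPull σ ((r : ℕ) + 1) f).symm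

theorem regularFun_apply (f : C(L, ℂ)) (r s : Fin K) :
    regularFun σ K f r s = if r = s then iterPull σ ((r : ℕ) + 1) f else 0 :=
  Matrix.diagonal_apply _ r s

theorem regularFun_mul (f : C(L, ℂ)) (M : CStarMatrix (Fin K) (Fin K) C(L, ℂ)) (r s : Fin K) :
    (regularFun σ K f * M) r s = iterPull σ ((r : ℕ) + 1) f * M r s :=
  Matrix.diagonal_mul _ _ _ _

variable (L) in
/-- The permutation matrix of the standard `K`-cycle. -/
def cyclicShift [NeZero K] : CStarMatrix (Fin K) (Fin K) C(L, ℂ) :=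
  cycleFill K fun _ => 1

theorem cyclicShift_apply [NeZero K] (r s : Fin K) :
    cyclicShift L K r s = if r = s + 1 then 1 else 0 := rfl

theorem cyclicShift_pow_apply [NeZero K] (n : ℕ) (r s : Fin K) :
    (cyclicShift L K ^ n) r s = if (r : ℕ) = (s + n) % K then 1 else 0 := by
  induction n generalizing r s with
  | zero =>
    rw [pow_zero, CStarMatrix.one_apply, add_zero, Nat.mod_eq_of_lt s.2]
    simp only [Fin.ext_iff]
  | succ n ih =>
    rw [pow_succ, CStarMatrix.mul_apply, Finset.sum_eq_single (s + 1)]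
    · rw [ih, cyclicShift_apply, if_pos rfl, mul_one]
      congr 2
      rw [Fin.val_add, Fin.val_one', Nat.add_mod_mod, Nat.mod_add_mod, add_assoc, add_comm 1 n]
    · intro j _ hj
      rw [cyclicShift_apply, if_neg hj, mul_zero]
    · exact fun hh => absurd (Finset.mem_univ _) hh

end RegularDefs

variable [CompactSpace L]

namespace IsCrossedProduct

variable {σ : L ≃ₜ* L} {K : ℕ} {D : Type*} [CStarAlgebra D] {φ : C(L, ℂ) →⋆ₐ[ℂ] D} {t : D}

theorem mem_closure_span (h : IsCrossedProduct σ K φ t) (hK : K ≠ 0) (x : D) :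
    x ∈ closure (Submodule.span ℂ (Set.range fun p : C(L, ℂ) × ℕ => φ p.1 * t ^ p.2) :
      Set D) := by
  refine mem_closure_span_of_cstarGenerated ?_ ?_ ?_ ?_ x
  · rw [eq_top_iff, ← h.generates]
    refine cstarGenerated_le (cstarGenerated.isClosed _) ?_
    rintro _ (⟨f, rfl⟩ | rfl)
    · exact mem_cstarGenerated ⟨(f, 0), by simp⟩
    · exact mem_cstarGenerated ⟨(1, 1), by simp⟩
  · exact ⟨(1, 0), by simp⟩
  · rintro _ ⟨p, rfl⟩ _ ⟨q, rfl⟩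
    exact ⟨(_, _), (h.mul_mul _ _ _ _).symm⟩
  · rintro _ ⟨p, rfl⟩
    exact ⟨(_, _), (h.star_mul hK _ _).symm⟩

theorem clm_ext (h : IsCrossedProduct σ K φ t) (hK : K ≠ 0) {F : Type*} [NormedAddCommGroup F]
    [NormedSpace ℂ F] {S T : D →L[ℂ] F} (hST : ∀ f n, S (φ f * t ^ n) = T (φ f * t ^ n)) :
    S = T := by
  refine ContinuousLinearMap.ext_on
    (dense_iff_closure_eq.2 (Set.eq_univ_of_forall (h.mem_closure_span hK))) ?_
  rintro _ ⟨p, rfl⟩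
  exact hST _ _

/-- The map `(f_i) ↦ ∑ f_i t^i` is onto the crossed product, because its partial inverse `R` is
continuous. -/
theorem exists_coeff (h : IsCrossedProduct σ K φ t) (hK : K ≠ 0) :
    ∃ R : D →L[ℂ] (Fin K → C(L, ℂ)),
      (∀ f n i, R (φ f * t ^ n) i = if (i : ℕ) = n % K then f else 0) ∧
      ∀ x, x = ∑ i : Fin K, φ (R x i) * t ^ (i : ℕ) := by
  obtain ⟨R, hR⟩ := h.coeff
  let S : D →L[ℂ] D := ∑ i : Fin K,
    ((ContinuousLinearMap.mul ℂ D).flip (t ^ (i : ℕ))).comp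
      (φ.toCLM.comp ((ContinuousLinearMap.proj i).comp R))
  have hS : ∀ y, S y = ∑ i : Fin K, φ (R y i) * t ^ (i : ℕ) := fun y => by
    simp [S, StarAlgHom.toCLM_apply]
  have hid : S = ContinuousLinearMap.id ℂ D := h.clm_ext hK fun f n => by
    rw [hS, Finset.sum_eq_single ⟨n % K, Nat.mod_lt _ (Nat.pos_of_ne_zero hK)⟩]
    · rw [hR, if_pos rfl, h.pow_mod]; rfl
    · intro i _ hi
      rw [hR, if_neg fun hh => hi (Fin.ext hh), map_zero, zero_mul]
    · exact fun hh => absurd (Finset.mem_univ _) hh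
  exact ⟨R, hR, fun x => by rw [← hS, hid]; rfl⟩

theorem mem_span (h : IsCrossedProduct σ K φ t) (hK : K ≠ 0) (x : D) :
    x ∈ Submodule.span ℂ (Set.range fun p : C(L, ℂ) × ℕ => φ p.1 * t ^ p.2) := by
  obtain ⟨R, -, hx⟩ := h.exists_coeff hK
  rw [hx x]
  exact Submodule.sum_mem _ fun i _ => Submodule.subset_span ⟨(_, _), rfl⟩

/-- The universal property of the crossed product, for targets in an arbitrary universe. -/
theorem exists_lift (h : IsCrossedProduct σ K φ t) (hK : K ≠ 0) {B : Type*} [CStarAlgebra B]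
    {ψ : C(L, ℂ) →⋆ₐ[ℂ] B} {s : B} (hs : IsCovariant σ K ψ s) :
    ∃ F : D →⋆ₐ[ℂ] B, (∀ f, F (φ f) = ψ f) ∧ F t = s := by
  obtain ⟨R, hR⟩ := h.coeff
  let F : D →ₗ[ℂ] B := ∑ i : Fin K, (LinearMap.mulRight ℂ (s ^ (i : ℕ))).comp
      (ψ.toCLM.toLinearMap.comp ((LinearMap.proj i).comp R.toLinearMap))
  have hF : ∀ f n, F (φ f * t ^ n) = ψ f * s ^ n := fun f n => by
    have hF' : F (φ f * t ^ n) = ∑ i : Fin K, ψ (R (φ f * t ^ n) i) * s ^ (i : ℕ) := by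
      simp [F, StarAlgHom.toCLM_apply]
    rw [hF', Finset.sum_eq_single ⟨n % K, Nat.mod_lt _ (Nat.pos_of_ne_zero hK)⟩]
    · rw [hR, if_pos rfl, hs.pow_mod]
    · intro i _ hi
      rw [hR, if_neg fun hh => hi (Fin.ext hh), map_zero, zero_mul]
    · exact fun hh => absurd (Finset.mem_univ _) hh
  have hφ : ∀ f, F (φ f) = ψ f := fun f => by simpa using hF f 0
  have hone : F 1 = 1 := by simpa using hF 1 0
  have hmul : ∀ x y, F (x * y) = F x * F y := fun x y => by
    refine Submodule.span_induction₂ (p := fun x y _ _ => F (x * y) = F x * F y)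
      ?_ ?_ ?_ ?_ ?_ ?_ ?_ (h.mem_span hK x) (h.mem_span hK y)
    · rintro _ _ ⟨p, rfl⟩ ⟨q, rfl⟩
      rw [h.mul_mul, hF, hF, hF, hs.mul_mul]
    · intro y _; rw [zero_mul, map_zero, zero_mul]
    · intro x _; rw [mul_zero, map_zero, mul_zero]
    · intro x y z _ _ _ h1 h2; rw [add_mul, map_add, h1, h2, map_add, add_mul]
    · intro x y z _ _ _ h1 h2; rw [mul_add, map_add, h1, h2, map_add, mul_add]
    · intro r x y _ _ hh; rw [smul_mul_assoc, map_smul, hh, map_smul, smul_mul_assoc]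
    · intro r x y _ _ hh; rw [mul_smul_comm, map_smul, hh, map_smul, mul_smul_comm]
  have hstar : ∀ x, F (star x) = star (F x) := fun x => by
    induction h.mem_span hK x using Submodule.span_induction with
    | mem y hy =>
      obtain ⟨p, rfl⟩ := hy
      simp only [h.star_mul hK, hF, hs.star_mul hK]
    | zero => rw [star_zero, map_zero, star_zero]
    | add y z _ _ hy hz => rw [star_add, map_add, hy, hz, map_add, star_add]
    | smul c y _ hy => rw [star_smul, map_smul, hy, map_smul, star_smul]
  refine ⟨{ toFun := F, map_one' := hone, map_mul' := hmul, map_zero' := map_zero F,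
            map_add' := map_add F, commutes' := fun c => ?_, map_star' := hstar }, hφ, ?_⟩
  · simp only [Algebra.algebraMap_eq_smul_one, map_smul, hone]
  · simpa using hF 1 1

end IsCrossedProduct

section Regular

variable {σ : L ≃ₜ* L} {K : ℕ}

theorem isCovariant_regular [NeZero K] (hσ : ∀ g, σ^[K] g = g) :
    IsCovariant σ K (regularFun σ K) (cyclicShift L K) := by
  have hpow : cyclicShift L K ^ K = 1 := by
    ext1 r s
    rw [cyclicShift_pow_apply, CStarMatrix.one_apply, Nat.add_mod_right, Nat.mod_eq_of_lt s.2]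
    simp only [Fin.ext_iff]
  have hright : cyclicShift L K * star (cyclicShift L K) = 1 := by
    ext1 r s
    rw [CStarMatrix.mul_apply, CStarMatrix.one_apply, Finset.sum_eq_single (r - 1)]
    · rw [CStarMatrix.star_apply, cyclicShift_apply, cyclicShift_apply, if_pos (by simp), one_mul]
      by_cases hrs : r = s
      · rw [if_pos (by simp [hrs]), if_pos hrs, star_one]
      · rw [if_neg (by simpa [eq_comm] using hrs), if_neg hrs, star_zero]
    · intro j _ hj
      rw [cyclicShift_apply, if_neg fun hh => hj (by simp [hh]), zero_mul]
    · exact fun hh => absurd (Finset.mem_univ _) hh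
  have hleft : star (cyclicShift L K) * cyclicShift L K = 1 := by
    have h1 : star (cyclicShift L K) = cyclicShift L K ^ (K - 1) := by
      calc star (cyclicShift L K)
          = cyclicShift L K ^ (K - 1 + 1) * star (cyclicShift L K) := by
            rw [Nat.sub_add_cancel (Nat.pos_of_ne_zero (NeZero.ne K)), hpow, one_mul]
        _ = cyclicShift L K ^ (K - 1) := by rw [pow_succ, mul_assoc, hright, mul_one]
    rw [h1, ← pow_succ, Nat.sub_add_cancel (Nat.pos_of_ne_zero (NeZero.ne K)), hpow]
  have hu : cyclicShift L K ∈ unitary _ := Unitary.mem_iff.2 ⟨hleft, hright⟩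
  refine ⟨hu, hpow, fun f => ?_⟩
  suffices h : cyclicShift L K * regularFun σ K f =
      regularFun σ K (f.comp (σ.symm : C(L, L))) * cyclicShift L K by
    rw [h, mul_assoc, hright, mul_one]
  ext1 r s
  rw [regularFun_mul, CStarMatrix.mul_apply, Finset.sum_eq_single s, regularFun_apply, if_pos rfl,
    cyclicShift_apply]
  · by_cases hrs : r = s + 1
    · rw [if_pos hrs, one_mul, mul_one]
      ext g
      change f (σ^[(s : ℕ) + 1] g) = f (σ.symm (σ^[(r : ℕ) + 1] g))
      rw [Function.iterate_succ_apply' σ (r : ℕ), σ.symm_apply_apply]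
      -- `s + 1` and `r` differ by a multiple of `K`
      by_cases hs : (s : ℕ) + 1 = K
      · have hr : (r : ℕ) = 0 := by
          rw [hrs, Fin.val_add, Fin.val_one', Nat.add_mod_mod, hs, Nat.mod_self]
        rw [hs, hr, hσ, Function.iterate_zero, id]
      · have hr : (r : ℕ) = s + 1 := by
          rw [hrs, Fin.val_add, Fin.val_one', Nat.add_mod_mod, Nat.mod_eq_of_lt (by omega)]
        rw [hr]
    · rw [if_neg hrs, zero_mul, mul_zero]
  · intro j _ hj
    rw [regularFun_apply, if_neg hj, mul_zero]
  · exact fun hh => absurd (Finset.mem_univ _) hh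

/-- A covariant pair generating a C*-algebra with a morphism to the regular representation presents
the crossed product: the coefficients can be read in the first column of the matrices. -/
theorem IsCrossedProduct.of_regular [NeZero K] {D : Type*} [CStarAlgebra D]
    {φ : C(L, ℂ) →⋆ₐ[ℂ] D} {t : D} (h : IsCovariant σ K φ t)
    (hgen : cstarGenerated (Set.range φ ∪ {t}) = ⊤)
    (Θ : D →⋆ₐ[ℂ] CStarMatrix (Fin K) (Fin K) C(L, ℂ))
    (hφ : ∀ f, Θ (φ f) = regularFun σ K f) (ht : Θ t = cyclicShift L K) :
    IsCrossedProduct σ K φ t := by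
  have hcont : ∀ n : ℕ, Continuous (iterPull σ.symm n) := fun n =>
    ContinuousMap.continuous_precomp
      (⟨σ.symm^[n], σ.symm.continuous.iterate n⟩ : C(L, L))
  refine ⟨h, hgen, ⟨{
    toFun := fun x i => iterPull σ.symm ((i : ℕ) + 1) (Θ x i 0)
    map_add' := fun x y => by ext i g; simp [iterPull_apply]
    map_smul' := fun c x => by ext i g; simp [iterPull_apply]
    cont := continuous_pi fun i => (hcont _).comp ?_ }, fun f n i => ?_⟩⟩
  · exact (continuous_apply_apply i (0 : Fin K)).comp (map_continuous Θ)
  · change iterPull σ.symm ((i : ℕ) + 1) (Θ (φ f * t ^ n) i 0) = _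
    rw [map_mul, map_pow, hφ, ht, regularFun_mul, cyclicShift_pow_apply]
    have h0 : ((0 : Fin K) : ℕ) + n = n := by simp
    rw [h0]
    split_ifs
    · rw [mul_one, iterPull_symm_iterPull]
    · rw [mul_zero]; rfl

/-- The regular representation of the crossed product is faithful. -/
theorem IsCrossedProduct.injective_regular [NeZero K] {D : Type*} [CStarAlgebra D]
    {φ : C(L, ℂ) →⋆ₐ[ℂ] D} {t : D} (h : IsCrossedProduct σ K φ t)
    (Θ : D →⋆ₐ[ℂ] CStarMatrix (Fin K) (Fin K) C(L, ℂ))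
    (hφ : ∀ f, Θ (φ f) = regularFun σ K f) (ht : Θ t = cyclicShift L K) :
    Function.Injective Θ := by
  obtain ⟨R, hR, hsum⟩ := h.exists_coeff (NeZero.ne K)
  -- the coefficients can be read in the first column of the matrices
  have key : ∀ (x : D) (i : Fin K), iterPull σ ((i : ℕ) + 1) (R x i) = Θ x i 0 := fun x i => by
    induction h.mem_span (NeZero.ne K) x using Submodule.span_induction with
    | mem y hy =>
      obtain ⟨⟨f, n⟩, rfl⟩ := hy
      rw [hR, map_mul, map_pow, hφ, ht, regularFun_mul, cyclicShift_pow_apply]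
      have h0 : ((0 : Fin K) : ℕ) + n = n := by simp
      rw [h0]
      split_ifs
      · rw [mul_one]
      · rw [mul_zero]; rfl
    | zero => rw [map_zero, map_zero]; rfl
    | add y z _ _ hy hz =>
      rw [map_add, map_add, CStarMatrix.add_apply, ← hy, ← hz]; rfl
    | smul c y _ hy => rw [map_smul, map_smul, CStarMatrix.smul_apply, ← hy]; rfl
  refine (injective_iff_map_eq_zero Θ).2 fun x hx => ?_
  rw [hsum x]
  refine Finset.sum_eq_zero fun i _ => ?_
  have h1 : R x i = 0 := by
    rw [← iterPull_symm_iterPull σ ((i : ℕ) + 1) (R x i), key, hx]; rfl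
  rw [h1, map_zero, zero_mul]

end Regular

end CrossedProducts

/-! ### Haar measure and the trace of the cyclic model -/

noncomputable section HaarTraces

open scoped CStarAlgebra InnerProductSpace

section Integrals

variable {X Y : Type*} [TopologicalSpace X] [CompactSpace X] [MeasurableSpace X] [BorelSpace X]
  (μ : Measure X) [IsProbabilityMeasure μ]
  [TopologicalSpace Y] [CompactSpace Y]

theorem integrable_continuousMap (f : C(X, ℂ)) : Integrable (fun x => f x) μ :=
  ⟨f.continuous.aestronglyMeasurable, HasFiniteIntegral.of_bounded (C := ‖f‖)
    (Filter.Eventually.of_forall fun x => f.norm_coe_le_norm x)⟩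

theorem norm_integral_continuousMap_le (f : C(X, ℂ)) : ‖∫ x, f x ∂μ‖ ≤ ‖f‖ := by
  simpa using norm_integral_le_of_norm_le_const (μ := μ) (f := fun x => f x) (C := ‖f‖)
    (Filter.Eventually.of_forall fun x => f.norm_coe_le_norm x)

/-- Integration against a probability measure, as a continuous functional on `C(X)`. -/
def integralCLM : C(X, ℂ) →L[ℂ] ℂ :=
  LinearMap.mkContinuous
    { toFun := fun f => ∫ x, f x ∂μ
      map_add' := fun f g =>
        integral_add (integrable_continuousMap μ f) (integrable_continuousMap μ g)
      map_smul' := fun c f => integral_const_mul c fun x => f x } 1 fun f => by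
    rw [one_mul]
    exact norm_integral_continuousMap_le μ f

theorem integralCLM_apply (f : C(X, ℂ)) : integralCLM μ f = ∫ x, f x ∂μ := rfl

/-- The partial integral `y ↦ ∫ F(x, y) dx`. -/
def fstIntegral : C(X × Y, ℂ) →L[ℂ] C(Y, ℂ) :=
  LinearMap.mkContinuous
    { toFun := fun F => (integralCLM μ : C(C(X, ℂ), ℂ)).comp (F.comp .prodSwap).curry
      map_add' := fun F G => by
        ext y
        exact (integralCLM μ).map_add ((F.comp .prodSwap).curry y) ((G.comp .prodSwap).curry y)
      map_smul' := fun c F => by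
        ext y
        exact (integralCLM μ).map_smul c ((F.comp .prodSwap).curry y) } 1 fun F => by
    rw [one_mul, ContinuousMap.norm_le _ (norm_nonneg F)]
    refine fun y => (norm_integral_continuousMap_le μ ((F.comp .prodSwap).curry y)).trans ?_
    exact (ContinuousMap.norm_le _ (norm_nonneg F)).2 fun x => F.norm_coe_le_norm (x, y)

/-- The partial integral `y ↦ ∫ F(y, x) dx`. -/
def sndIntegral : C(Y × X, ℂ) →L[ℂ] C(Y, ℂ) :=
  (fstIntegral μ).comp
    (ContinuousMap.compCLM ℂ ℂ ContinuousMap.prodSwap)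

end Integrals

section Haar

variable {L : Type*} [Group L] [TopologicalSpace L] [IsTopologicalGroup L] [CompactSpace L]
  [MeasurableSpace L] [BorelSpace L] (μ : Measure L) [μ.IsHaarMeasure] [IsProbabilityMeasure μ]

theorem integral_iterPull (σ : L ≃ₜ* L) (n : ℕ) (f : C(L, ℂ)) :
    ∫ g, iterPull σ n f g ∂μ = ∫ g, f g ∂μ := by
  have hm : μ.map σ = μ := by
    have : IsProbabilityMeasure (μ.map σ) :=
      Measure.isProbabilityMeasure_map σ.continuous.measurable.aemeasurable
    exact Measure.isHaarMeasure_eq_of_isProbabilityMeasure _ _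
  have hmp : MeasurePreserving σ μ μ := ⟨σ.continuous.measurable, hm⟩
  conv_rhs => rw [← (hmp.iterate n).map_eq]
  exact (integral_map (hmp.iterate n).measurable.aemeasurable
    f.continuous.aestronglyMeasurable).symm

theorem integral_mul_right_haar (f : C(L, ℂ)) (h : L) : ∫ g, f (g * h) ∂μ = ∫ g, f g ∂μ := by
  have hm : μ.map (· * h) = μ := by
    have : IsProbabilityMeasure (μ.map (· * h)) :=
      Measure.isProbabilityMeasure_map (continuous_mul_const h).measurable.aemeasurable
    exact Measure.isHaarMeasure_eq_of_isProbabilityMeasure _ _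
  conv_rhs => rw [← hm]
  exact (integral_map (continuous_mul_const h).measurable.aemeasurable
    f.continuous.aestronglyMeasurable).symm

theorem integral_mul_left_haar (f : C(L, ℂ)) (h : L) : ∫ g, f (h * g) ∂μ = ∫ g, f g ∂μ := by
  conv_rhs => rw [← map_mul_left_eq_self μ h]
  exact (integral_map (continuous_const_mul h).measurable.aemeasurable
    f.continuous.aestronglyMeasurable).symm

/-- The functional `tr ⊗ ∫_L` on `M_K(C(L))`, where `tr` is the normalized trace. -/
def haarTrace (K : ℕ) : CStarMatrix (Fin K) (Fin K) C(L, ℂ) →ₗ[ℂ] ℂ where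
  toFun M := (K : ℂ)⁻¹ * ∑ r, integralCLM μ (M r r)
  map_add' M M' := by
    simp only [CStarMatrix.add_apply, map_add, Finset.sum_add_distrib, mul_add]
  map_smul' c M := by
    simp only [CStarMatrix.smul_apply, map_smul, smul_eq_mul, ← Finset.mul_sum, RingHom.id_apply]
    ring

theorem haarTrace_apply (K : ℕ) (M : CStarMatrix (Fin K) (Fin K) C(L, ℂ)) :
    haarTrace μ K M = (K : ℂ)⁻¹ * ∑ r, ∫ g, (M r r : C(L, ℂ)) g ∂μ := rfl

theorem haarTrace_star_mul_self (K : ℕ) (M : CStarMatrix (Fin K) (Fin K) C(L, ℂ)) :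
    haarTrace μ K (star M * M) =
      (((K : ℝ)⁻¹ * ∑ r, ∑ s, ∫ g, ‖(M s r : C(L, ℂ)) g‖ ^ 2 ∂μ : ℝ) : ℂ) := by
  have h : ∀ r s, integralCLM μ ((star M) r s * M s r) =
      ((∫ g, ‖(M s r : C(L, ℂ)) g‖ ^ 2 ∂μ : ℝ) : ℂ) := fun r s => by
    change ∫ g, star ((M s r : C(L, ℂ)) g) * (M s r : C(L, ℂ)) g ∂μ = _
    rw [← integral_complex_ofReal]
    refine integral_congr_ae (Filter.Eventually.of_forall fun g => ?_)
    change star ((M s r : C(L, ℂ)) g) * (M s r : C(L, ℂ)) g = _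
    rw [Complex.star_def, Complex.conj_mul']
    norm_cast
  change (K : ℂ)⁻¹ * ∑ r, integralCLM μ ((star M * M) r r) = _
  simp only [CStarMatrix.mul_apply, map_sum, h]
  push_cast
  rfl

theorem isState_haarTrace (K : ℕ) [NeZero K] : IsState (haarTrace μ K) := by
  refine ⟨fun M => ?_, ?_⟩
  · rw [haarTrace_star_mul_self, Complex.zero_le_real]
    exact mul_nonneg (by positivity) (Finset.sum_nonneg fun r _ => Finset.sum_nonneg fun s _ =>
      integral_nonneg fun g => by positivity)
  · rw [haarTrace_apply]
    simp [NeZero.ne K]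

/-- The Haar measure charges every nonempty open set, so that `tr ⊗ ∫_L` is faithful. -/
theorem eq_zero_of_haarTrace_star_mul_self {K : ℕ} [NeZero K]
    {M : CStarMatrix (Fin K) (Fin K) C(L, ℂ)} (hM : haarTrace μ K (star M * M) = 0) : M = 0 := by
  have hnn : ∀ r s, 0 ≤ ∫ g, ‖(M s r : C(L, ℂ)) g‖ ^ 2 ∂μ := fun r s =>
    integral_nonneg fun g => by positivity
  rw [haarTrace_star_mul_self, Complex.ofReal_eq_zero, mul_eq_zero,
    or_iff_right (inv_ne_zero (Nat.cast_ne_zero.2 (NeZero.ne K))),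
    Finset.sum_eq_zero_iff_of_nonneg fun r _ => Finset.sum_nonneg fun s _ => hnn r s] at hM
  ext s r g
  have h1 := (Finset.sum_eq_zero_iff_of_nonneg fun s _ => hnn r s).1 (hM r (Finset.mem_univ r)) s
    (Finset.mem_univ s)
  have hcont : Continuous fun g => ‖(M s r : C(L, ℂ)) g‖ ^ 2 :=
    (M s r : C(L, ℂ)).continuous.norm.pow 2
  by_contra hne
  refine (hcont.integral_pos_of_hasCompactSupport_nonneg_nonzero (μ := μ) (x := g)
    (HasCompactSupport.of_compactSpace _) (fun g => by positivity) ?_).ne' h1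
  exact pow_ne_zero 2 (norm_ne_zero_iff.2 hne)

theorem haarTrace_regular (σ : L ≃ₜ* L) (K : ℕ) [NeZero K] (f : C(L, ℂ)) (n : ℕ) :
    haarTrace μ K (regularFun σ K f * cyclicShift L K ^ n) =
      if n % K = 0 then ∫ g, f g ∂μ else 0 := by
  have hiff : ∀ r : Fin K, (r : ℕ) = (r + n) % K ↔ n % K = 0 := fun r => by
    rw [← Nat.dvd_iff_mod_eq_zero, ← Nat.modEq_zero_iff_dvd]
    constructor
    · intro h
      refine Nat.ModEq.add_left_cancel' (r : ℕ) (?_ : (r + n) % K = (r + 0) % K)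
      rw [← h, add_zero, Nat.mod_eq_of_lt r.2]
    · intro h
      have h' : (r + n) % K = (r + 0) % K := h.add_left (r : ℕ)
      rw [h', add_zero, Nat.mod_eq_of_lt r.2]
  change (K : ℂ)⁻¹ * ∑ r, integralCLM μ ((regularFun σ K f * cyclicShift L K ^ n) r r) = _
  simp only [regularFun_mul, cyclicShift_pow_apply, hiff]
  split_ifs
  · simp only [mul_one, integralCLM_apply, integral_iterPull]
    simp [NeZero.ne K]
  · simp

end Haar

/-! ### The GNS representation of a faithful state -/

section GNS

variable {A : Type u} [CStarAlgebra A]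

theorem IsState.comp {D : Type*} [CStarAlgebra D] {h : D →ₗ[ℂ] ℂ} (hh : IsState h)
    (ι : A →⋆ₐ[ℂ] D) : IsState (h.comp ι.toAlgHom.toLinearMap) := by
  refine ⟨fun a => ?_, ?_⟩
  · change 0 ≤ h (ι (star a * a))
    rw [map_mul, map_star]
    exact hh.1 _
  · change h (ι 1) = 1
    rw [map_one, hh.2]

theorem IsState.exists_positiveLinearMap [PartialOrder A] [StarOrderedRing A]
    {h : A →ₗ[ℂ] ℂ} (hh : IsState h) :
    ∃ f : A →ₚ[ℂ] ℂ, ∀ a, f a = h a :=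
  ⟨PositiveLinearMap.mk₀ h fun x hx => by
    obtain ⟨b, rfl⟩ := CStarAlgebra.nonneg_iff_eq_star_mul_self.1 hx
    exact hh.1 b, fun _ => rfl⟩

theorem IsState.continuous {h : A →ₗ[ℂ] ℂ} (hh : IsState h) : Continuous h := by
  let := CStarAlgebra.spectralOrder A
  let := CStarAlgebra.spectralOrderedRing A
  obtain ⟨f, hf⟩ := hh.exists_positiveLinearMap
  exact (map_continuous f).congr hf

/-- A state is a vector state of its GNS representation, which is faithful if the state is. -/
theorem IsState.exists_hilbertRep {h : A →ₗ[ℂ] ℂ} (hh : IsState h)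
    (hfaith : ∀ a, h (star a * a) = 0 → a = 0) :
    ∃ (π : HilbertRep A) (Ω : π.H), Function.Injective π.rep ∧ ∀ a, ⟪Ω, π.rep a Ω⟫_ℂ = h a := by
  let := CStarAlgebra.spectralOrder A
  let := CStarAlgebra.spectralOrderedRing A
  obtain ⟨f, hf⟩ := hh.exists_positiveLinearMap
  let Ω : f.GNS := ((f.toPreGNS 1 : f.PreGNS) : f.GNS)
  have hΩ : ∀ a, f.gnsStarAlgHom a Ω = ((f.toPreGNS a : f.PreGNS) : f.GNS) := fun a => by
    change f.gnsNonUnitalStarAlgHom a Ω = _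
    rw [PositiveLinearMap.gnsNonUnitalStarAlgHom_apply_coe]
    simp
  have hinner : ∀ a b, ⟪((f.toPreGNS a : f.PreGNS) : f.GNS), ((f.toPreGNS b : f.PreGNS) : f.GNS)⟫_ℂ
      = h (star a * b) := fun a b => by
    rw [UniformSpace.Completion.inner_coe, PositiveLinearMap.preGNS_inner_def, hf]
    rfl
  have hnt : Nontrivial f.GNS := ⟨⟨Ω, 0, fun h0 => by
    have := hinner 1 1
    rw [show ((f.toPreGNS 1 : f.PreGNS) : f.GNS) = 0 from h0, inner_zero_left, star_one, mul_one,
      hh.2] at this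
    exact zero_ne_one this⟩⟩
  refine ⟨{ H := f.GNS, rep := f.gnsStarAlgHom }, Ω, ?_, fun a => ?_⟩
  · refine (injective_iff_map_eq_zero f.gnsStarAlgHom).2 fun a ha => hfaith a ?_
    rw [← hinner, ← hΩ a, ha, _root_.zero_apply, inner_zero_left]
  · change ⟪Ω, f.gnsStarAlgHom a Ω⟫_ℂ = h a
    rw [hΩ, hinner, star_one, one_mul]

end GNS

end HaarTraces

/-! ### The quantum group attached to a crossed product -/

noncomputable section BracketQuantumGroups

open scoped CStarAlgebra InnerProductSpace

variable {L : Type*} [Group L] [TopologicalSpace L] {σ : L ≃ₜ* L} {K N : ℕ}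

section Coefficients

variable (v : L →ₜ* Matrix.unitaryGroup (Fin N) ℂ)

theorem repCoeff_apply (i j : Fin N) (g : L) :
    repCoeff v i j g = (v g : Matrix (Fin N) (Fin N) ℂ) i j := rfl

theorem repCoeff_mul (i j : Fin N) (g h : L) :
    repCoeff v i j (g * h) = ∑ k, repCoeff v i k g * repCoeff v k j h := by
  simp only [repCoeff_apply, map_mul, Submonoid.coe_mul, Matrix.mul_apply]

theorem repCoeff_one (i j : Fin N) : repCoeff v i j 1 = if i = j then 1 else 0 := by
  rw [repCoeff_apply, map_one, OneMemClass.coe_one, Matrix.one_apply]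

theorem repCoeff_inv (i j : Fin N) (g : L) : repCoeff v i j g⁻¹ = star (repCoeff v j i g) := by
  rw [repCoeff_apply, map_inv]
  rfl

theorem sum_repCoeff_mul_star (i j : Fin N) :
    ∑ k, repCoeff v i k * star (repCoeff v j k) = if i = j then 1 else 0 := by
  ext g
  have h := repCoeff_mul v i j g g⁻¹
  rw [mul_inv_cancel, repCoeff_one] at h
  simp only [repCoeff_inv] at h
  rw [ContinuousMap.sum_apply]
  refine (h.symm.trans ?_ : _)
  split_ifs <;> rfl

theorem sum_star_repCoeff_mul (i j : Fin N) :
    ∑ k, star (repCoeff v k i) * repCoeff v k j = if i = j then 1 else 0 := by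
  ext g
  have h := repCoeff_mul v i j g⁻¹ g
  rw [inv_mul_cancel, repCoeff_one] at h
  simp only [repCoeff_inv] at h
  rw [ContinuousMap.sum_apply]
  refine (h.symm.trans ?_ : _)
  split_ifs <;> rfl

end Coefficients

section Relations

variable {B : Type*} [CStarAlgebra B] {φ : C(L, ℂ) →⋆ₐ[ℂ] B} {t : B}

theorem IsCovariant.mul_mul_star_mul (h : IsCovariant σ K φ t) (f g : C(L, ℂ)) :
    (φ f * t) * star (φ g * t) = φ (f * star g) := by
  rw [StarMul.star_mul, mul_assoc, ← mul_assoc t, (Unitary.mem_iff.1 h.isUnitary).2, one_mul,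
    map_mul, map_star]

theorem IsCovariant.star_mul_mul_mul (h : IsCovariant σ K φ t) (f g : C(L, ℂ)) :
    star (φ f * t) * (φ g * t) = φ ((star f * g).comp (σ : C(L, L))) := by
  have hf : ∀ f : C(L, ℂ), star t * φ f * t = φ (f.comp (σ : C(L, L))) := fun f => by
    have h1 : f = (f.comp (σ : C(L, L))).comp (σ.symm : C(L, L)) := by
      ext x
      exact congrArg f (σ.apply_symm_apply x).symm
    conv_lhs => rw [h1, ← h.covariant]
    rw [mul_assoc, mul_assoc, (Unitary.mem_iff.1 h.isUnitary).1, mul_one, ← mul_assoc,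
      (Unitary.mem_iff.1 h.isUnitary).1, one_mul]
  rw [StarMul.star_mul, ← hf, map_mul, map_star]
  simp only [mul_assoc]

/-- The products `ab^*` and `a^*b` of coordinates `v_ij τ` belong to the commutative algebra
`C(L)`. -/
theorem IsCovariant.isHalfLiberated (h : IsCovariant σ K φ t)
    (v : L →ₜ* Matrix.unitaryGroup (Fin N) ℂ) {x : Matrix (Fin N) (Fin N) B}
    (hx : ∀ i j, x i j = φ (repCoeff v i j) * t) : IsHalfLiberated x := by
  have hite : ∀ i j : Fin N, φ (if i = j then 1 else 0) = if i = j then 1 else 0 := fun i j => by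
    split_ifs <;> simp
  have hite' : ∀ i j : Fin N, ((if i = j then 1 else 0 : C(L, ℂ)).comp (σ : C(L, L))) =
      if i = j then 1 else 0 := fun i j => by split_ifs <;> rfl
  have hcomp : ∀ F : Fin N → C(L, ℂ), ∑ k, φ ((F k).comp (σ : C(L, L))) =
      φ ((∑ k, F k).comp (σ : C(L, L))) := fun F => by
    rw [← map_sum]
    congr 1
    ext x
    simp
  refine ⟨Unitary.mem_iff.2 ⟨?_, ?_⟩, Unitary.mem_iff.2 ⟨?_, ?_⟩, ?_⟩
  · ext i j
    simp only [Matrix.mul_apply, Matrix.star_apply, hx, h.star_mul_mul_mul, hcomp,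
      sum_star_repCoeff_mul, hite', hite, Matrix.one_apply]
  · ext i j
    simp only [Matrix.mul_apply, Matrix.star_apply, hx, h.mul_mul_star_mul, ← map_sum,
      sum_repCoeff_mul_star, hite, Matrix.one_apply]
  · ext i j
    simp only [Matrix.mul_apply, Matrix.star_apply, Matrix.map_apply, star_star,
      hx, h.mul_mul_star_mul, ← map_sum, Matrix.one_apply]
    rw [Finset.sum_congr rfl fun k _ => mul_comm (repCoeff v k i) (star (repCoeff v k j)),
      sum_star_repCoeff_mul, hite]
    simp only [eq_comm]
  · ext i j
    simp only [Matrix.mul_apply, Matrix.star_apply, Matrix.map_apply, star_star,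
      hx, h.star_mul_mul_mul, hcomp, Matrix.one_apply]
    rw [Finset.sum_congr rfl fun k _ => mul_comm (star (repCoeff v i k)) (repCoeff v j k),
      sum_repCoeff_mul_star, hite', hite]
    simp only [eq_comm]
  · have hmem : ∀ y ∈ {y | ∃ i j k l, y = x i j * star (x k l) ∨ y = star (x i j) * x k l},
        ∃ f, y = φ f := by
      rintro _ ⟨i, j, k, l, rfl | rfl⟩
      · exact ⟨_, by rw [hx, hx, h.mul_mul_star_mul]⟩
      · exact ⟨_, by rw [hx, hx, h.star_mul_mul_mul]⟩
    intro y hy z hz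
    obtain ⟨f, rfl⟩ := hmem y hy
    obtain ⟨g, rfl⟩ := hmem z hz
    exact (Commute.all f g).map φ

end Relations

section MulMap

variable [IsTopologicalGroup L] {D : Type u} [CStarAlgebra D] {φ : C(L, ℂ) →⋆ₐ[ℂ] D}

variable (L) in
/-- The multiplication of `L`. -/
def mulMap : C(L × L, L) := ⟨fun p => p.1 * p.2, continuous_mul⟩

/-- The comultiplication extends that of `C(L)`. -/
theorem comul_fun_eq_sum {T : C(L × L, ℂ) →⋆ₐ[ℂ] MinT D D} {Δ : D →⋆ₐ[ℂ] MinT D D}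
    (hT : ∀ a b, T (a.prodMul b) = MinT.tmul (φ a) (φ b))
    (hΔ : ∀ f, Δ (φ f) = T (f.comp (mulMap L))) (f : C(L, ℂ)) {ι : Type*} [Fintype ι]
    (a b : ι → C(L, ℂ)) (hf : ∀ g h, f (g * h) = ∑ m, a m g * b m h) :
    Δ (φ f) = ∑ m, MinT.tmul (φ (a m)) (φ (b m)) := by
  have h1 : f.comp (mulMap L) = ∑ m, (a m).prodMul (b m) := by
    ext p
    rw [ContinuousMap.sum_apply]
    exact hf p.1 p.2
  rw [hΔ, h1, map_sum]
  exact Finset.sum_congr rfl fun m _ => hT _ _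

end MulMap

section Comultiplication

variable [CompactSpace L] [IsTopologicalGroup L] [T2Space L] [NeZero K]
  {D : Type u} [CStarAlgebra D] {φ : C(L, ℂ) →⋆ₐ[ℂ] D} {t : D}

/-- The comultiplication of `L ⋊ ℤ_K`, together with the morphism
`C(L × L) → C(L ⋊ ℤ_K) ⊗ C(L ⋊ ℤ_K)`. -/
theorem IsCrossedProduct.exists_comul (h : IsCrossedProduct σ K φ t) :
    ∃ (T : C(L × L, ℂ) →⋆ₐ[ℂ] MinT D D) (Δ : D →⋆ₐ[ℂ] MinT D D),
      (∀ a b, T (a.prodMul b) = MinT.tmul (φ a) (φ b)) ∧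
      (∀ f, Δ (φ f) = T (f.comp (mulMap L))) ∧ Δ t = MinT.tmul t t := by
  obtain ⟨T, hT⟩ := ContinuousMap.exists_starAlgHom_prod ((MinT.inl : D →⋆ₐ[ℂ] MinT D D).comp φ)
    ((MinT.inr : D →⋆ₐ[ℂ] MinT D D).comp φ) fun a b => by
      change MinT.tmul (φ a) 1 * MinT.tmul 1 (φ b) = MinT.tmul 1 (φ b) * MinT.tmul (φ a) 1
      rw [← MinT.tmul_mul, ← MinT.tmul_mul, one_mul, mul_one, one_mul, mul_one]
  have hT' : ∀ a b, T (a.prodMul b) = MinT.tmul (φ a) (φ b) := fun a b => by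
    rw [hT]
    change MinT.tmul (φ a) 1 * MinT.tmul 1 (φ b) = _
    rw [← MinT.tmul_mul, one_mul, mul_one]
  let s : C(L, L) := (σ.symm : C(L, L))
  have hcov : ∀ F : C(L × L, ℂ),
      MinT.tmul t t * T F * star (MinT.tmul t t) = T (F.comp (s.prodMap s)) := fun F => by
    let S₁ : C(L × L, ℂ) →L[ℂ] MinT D D :=
      ((ContinuousLinearMap.mul ℂ (MinT D D)).flip (star (MinT.tmul t t))).comp
        ((ContinuousLinearMap.mul ℂ (MinT D D) (MinT.tmul t t)).comp T.toCLM)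
    let S₂ : C(L × L, ℂ) →L[ℂ] MinT D D :=
      T.toCLM.comp (ContinuousMap.compCLM ℂ ℂ (s.prodMap s))
    have hS : S₁ = S₂ := ContinuousMap.clm_ext_prod fun a b => by
      change MinT.tmul t t * T (a.prodMul b) * star (MinT.tmul t t) =
        T ((a.comp s).prodMul (b.comp s))
      rw [hT', hT', ← MinT.tmul_star, ← MinT.tmul_mul, ← MinT.tmul_mul, h.covariant, h.covariant]
    exact DFunLike.congr_fun hS F
  let M : C(L, ℂ) →⋆ₐ[ℂ] C(L × L, ℂ) := (mulMap L).compStarAlgHom' ℂ ℂ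
  have hs : IsCovariant σ K (T.comp M) (MinT.tmul t t) := by
    refine ⟨Unitary.mem_iff.2 ⟨?_, ?_⟩, ?_, fun f => ?_⟩
    · rw [← MinT.tmul_star, ← MinT.tmul_mul, (Unitary.mem_iff.1 h.isUnitary).1, MinT.tmul_one]
    · rw [← MinT.tmul_star, ← MinT.tmul_mul, (Unitary.mem_iff.1 h.isUnitary).2, MinT.tmul_one]
    · rw [MinT.tmul_pow, h.pow_eq, MinT.tmul_one]
    · refine (hcov (M f)).trans (congrArg T ?_)
      ext p
      exact congrArg f (map_mul σ.symm p.1 p.2).symm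
  obtain ⟨Δ, hΔ, hΔt⟩ := h.exists_lift (NeZero.ne K) hs
  exact ⟨T, Δ, hT', hΔ, hΔt⟩

variable [MeasurableSpace L] [BorelSpace L] (μ : Measure L) [μ.IsHaarMeasure]
  [IsProbabilityMeasure μ]

/-- A slice map of the Haar state in the first factor sends the comultiplication to the Haar
state. On `f τ^n` this is the invariance of the Haar measure of `L`, under the integral sign of
`∫ F(x, y) dx` with `F(x, y) = f(xy)`. -/
theorem IsCrossedProduct.leftSlice_comul (h : IsCrossedProduct σ K φ t)
    {T : C(L × L, ℂ) →⋆ₐ[ℂ] MinT D D} {Δ : D →⋆ₐ[ℂ] MinT D D}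
    (hT : ∀ a b, T (a.prodMul b) = MinT.tmul (φ a) (φ b))
    (hΔ : ∀ f, Δ (φ f) = T (f.comp (mulMap L))) (hΔt : Δ t = MinT.tmul t t)
    {χ : D →L[ℂ] ℂ} (hχ : ∀ f n, χ (φ f * t ^ n) = if n % K = 0 then ∫ g, f g ∂μ else 0)
    {R : MinT D D →L[ℂ] D} (hR : ∀ a b, R (MinT.tmul a b) = χ a • b) (x : D) :
    R (Δ x) = χ x • 1 := by
  have key : R.comp Δ.toCLM = χ.smulRight 1 := h.clm_ext (NeZero.ne K) fun f n => by
    change R (Δ (φ f * t ^ n)) = χ (φ f * t ^ n) • 1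
    rw [map_mul, map_pow, hΔ, hΔt, MinT.tmul_pow, hχ]
    let S₁ : C(L × L, ℂ) →L[ℂ] D :=
      R.comp (((ContinuousLinearMap.mul ℂ (MinT D D)).flip (MinT.tmul (t ^ n) (t ^ n))).comp
        T.toCLM)
    let S₂ : C(L × L, ℂ) →L[ℂ] D :=
      if n % K = 0 then φ.toCLM.comp (fstIntegral μ) else 0
    have hS : S₁ = S₂ := ContinuousMap.clm_ext_prod fun a b => by
      change R (T (a.prodMul b) * MinT.tmul (t ^ n) (t ^ n)) = _
      rw [hT, ← MinT.tmul_mul, hR, hχ]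
      by_cases hn : n % K = 0
      · simp only [S₂, if_pos hn]
        have ht : t ^ n = 1 := by rw [← h.pow_mod, hn, pow_zero]
        have hab : fstIntegral μ (a.prodMul b) = (∫ g, a g ∂μ) • b := by
          ext y
          exact integral_mul_const (b y) fun x => a x
        change _ = φ (fstIntegral μ (a.prodMul b))
        rw [ht, mul_one, hab, map_smul]
      · simp only [S₂, if_neg hn, zero_smul]
        rfl
    refine (DFunLike.congr_fun hS (f.comp (mulMap L))).trans ?_
    by_cases hn : n % K = 0
    · simp only [S₂, if_pos hn]
      have hf : fstIntegral μ (f.comp (mulMap L)) = (∫ g, f g ∂μ) • 1 := by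
        ext y
        refine (integral_mul_right_haar μ f y).trans ?_
        simp
      change φ (fstIntegral μ (f.comp (mulMap L))) = _
      rw [hf, map_smul, map_one]
    · simp only [S₂, if_neg hn, zero_smul]
      rfl
  exact DFunLike.congr_fun key x

/-- The counterpart of `IsCrossedProduct.leftSlice_comul` for the second factor, with the partial
integral `∫ F(x, y) dy`. -/
theorem IsCrossedProduct.rightSlice_comul (h : IsCrossedProduct σ K φ t)
    {T : C(L × L, ℂ) →⋆ₐ[ℂ] MinT D D} {Δ : D →⋆ₐ[ℂ] MinT D D}
    (hT : ∀ a b, T (a.prodMul b) = MinT.tmul (φ a) (φ b))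
    (hΔ : ∀ f, Δ (φ f) = T (f.comp (mulMap L))) (hΔt : Δ t = MinT.tmul t t)
    {χ : D →L[ℂ] ℂ} (hχ : ∀ f n, χ (φ f * t ^ n) = if n % K = 0 then ∫ g, f g ∂μ else 0)
    {R : MinT D D →L[ℂ] D} (hR : ∀ a b, R (MinT.tmul a b) = χ b • a) (x : D) :
    R (Δ x) = χ x • 1 := by
  have key : R.comp Δ.toCLM = χ.smulRight 1 := h.clm_ext (NeZero.ne K) fun f n => by
    change R (Δ (φ f * t ^ n)) = χ (φ f * t ^ n) • 1
    rw [map_mul, map_pow, hΔ, hΔt, MinT.tmul_pow, hχ]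
    let S₁ : C(L × L, ℂ) →L[ℂ] D :=
      R.comp (((ContinuousLinearMap.mul ℂ (MinT D D)).flip (MinT.tmul (t ^ n) (t ^ n))).comp
        T.toCLM)
    let S₂ : C(L × L, ℂ) →L[ℂ] D :=
      if n % K = 0 then φ.toCLM.comp (sndIntegral μ) else 0
    have hS : S₁ = S₂ := ContinuousMap.clm_ext_prod fun a b => by
      change R (T (a.prodMul b) * MinT.tmul (t ^ n) (t ^ n)) = _
      rw [hT, ← MinT.tmul_mul, hR, hχ]
      by_cases hn : n % K = 0
      · simp only [S₂, if_pos hn]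
        have ht : t ^ n = 1 := by rw [← h.pow_mod, hn, pow_zero]
        have hab : sndIntegral μ (a.prodMul b) = (∫ g, b g ∂μ) • a := by
          ext y
          refine (integral_const_mul (a y) fun x => b x).trans ?_
          exact mul_comm _ _
        change _ = φ (sndIntegral μ (a.prodMul b))
        rw [ht, mul_one, hab, map_smul]
      · simp only [S₂, if_neg hn, zero_smul]
        rfl
    refine (DFunLike.congr_fun hS (f.comp (mulMap L))).trans ?_
    by_cases hn : n % K = 0
    · simp only [S₂, if_pos hn]
      have hf : sndIntegral μ (f.comp (mulMap L)) = (∫ g, f g ∂μ) • 1 := by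
        ext y
        refine (integral_mul_left_haar μ f y).trans ?_
        simp
      change φ (sndIntegral μ (f.comp (mulMap L))) = _
      rw [hf, map_smul, map_one]
    · simp only [S₂, if_neg hn, zero_smul]
      rfl
  exact DFunLike.congr_fun key x

end Comultiplication

end BracketQuantumGroups

/-! ### The quotient generated by the coordinates -/

noncomputable section Brackets

open scoped CStarAlgebra InnerProductSpace

/-- The data describing `C([L]) ⊂ C(L ⋊ ℤ_K)`: a crossed product `D`, with a morphism `Θ` to
`M_K(C(L))` extending the regular representation, and a C*-algebra `A` generated by elements
`x_ij`, with an injective morphism `ι : A → D` such that `ι(x_ij) = v_ij τ`. -/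
structure IsBracket {L : Type*} [Group L] [TopologicalSpace L] [CompactSpace L] (σ : L ≃ₜ* L)
    {K N : ℕ} [NeZero K] (v : L →ₜ* Matrix.unitaryGroup (Fin N) ℂ) {D A : Type u}
    [CStarAlgebra D] [CStarAlgebra A] (φ : C(L, ℂ) →⋆ₐ[ℂ] D) (t : D)
    (Θ : D →⋆ₐ[ℂ] CStarMatrix (Fin K) (Fin K) C(L, ℂ)) (ι : A →⋆ₐ[ℂ] D)
    (x : Matrix (Fin N) (Fin N) A) : Prop extends IsCrossedProduct σ K φ t where
  regular_fun : ∀ f, Θ (φ f) = regularFun σ K f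
  regular_gen : Θ t = cyclicShift L K
  injective : Function.Injective ι
  coord : ∀ i j, ι (x i j) = φ (repCoeff v i j) * t
  generates_coord : cstarGenerated (Set.range fun p : Fin N × Fin N => x p.1 p.2) = ⊤

namespace IsBracket

variable {L : Type*} [Group L] [TopologicalSpace L] [IsTopologicalGroup L] [CompactSpace L]
  [T2Space L] {σ : L ≃ₜ* L} {K N : ℕ} [NeZero K]
  {v : L →ₜ* Matrix.unitaryGroup (Fin N) ℂ} {D A : Type u} [CStarAlgebra D] [CStarAlgebra A]
  {φ : C(L, ℂ) →⋆ₐ[ℂ] D} {t : D} {Θ : D →⋆ₐ[ℂ] CStarMatrix (Fin K) (Fin K) C(L, ℂ)}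
  {ι : A →⋆ₐ[ℂ] D} {x : Matrix (Fin N) (Fin N) A}

theorem exists_counit (h : IsBracket σ v φ t Θ ι x) :
    ∃ ε : A →⋆ₐ[ℂ] ℂ, ∀ i j, ε (x i j) = if i = j then 1 else 0 := by
  have hs : IsCovariant σ K (ContinuousMap.evalStarAlgHom ℂ ℂ (1 : L)) (1 : ℂ) := by
    refine ⟨one_mem _, one_pow _, fun f => ?_⟩
    rw [star_one, one_mul, mul_one]
    exact congrArg f (map_one σ.symm).symm
  obtain ⟨F, hF, hFt⟩ := h.exists_lift (NeZero.ne K) hs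
  refine ⟨F.comp ι, fun i j => ?_⟩
  rw [StarAlgHom.comp_apply, h.coord, map_mul, hF, hFt, mul_one, ← repCoeff_one v]
  rfl

/-- The antipode of `L ⋊ ℤ_K` is `f τ^n ↦ τ^{-n} f(g⁻¹)`, with values in the opposite algebra. -/
theorem exists_antipode (h : IsBracket σ v φ t Θ ι x) :
    ∃ S : A →⋆ₐ[ℂ] Aᵐᵒᵖ, ∀ i j, S (x i j) = MulOpposite.op (star (x j i)) := by
  let inv : C(L, L) := ⟨fun g => g⁻¹, continuous_inv⟩
  let ψ : C(L, ℂ) →⋆ₐ[ℂ] Dᵐᵒᵖ :=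
    { toFun := fun f => MulOpposite.op (φ (f.comp inv))
      map_one' := congrArg MulOpposite.op (map_one φ)
      map_mul' := fun f g => by
        rw [← MulOpposite.op_mul, ← map_mul, mul_comm]
        rfl
      map_zero' := congrArg MulOpposite.op (map_zero φ)
      map_add' := fun f g => by
        rw [← MulOpposite.op_add, ← map_add]
        rfl
      commutes' := fun c => congrArg MulOpposite.op (AlgHomClass.commutes φ c)
      map_star' := fun f => by
        rw [← MulOpposite.op_star, ← map_star]
        rfl }
  have hs : IsCovariant σ K ψ (MulOpposite.op (star t)) := by
    refine ⟨Unitary.mem_iff.2 ⟨?_, ?_⟩, ?_, fun f => ?_⟩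
    · rw [← MulOpposite.op_star, ← MulOpposite.op_mul, star_star, MulOpposite.op_eq_one_iff,
        (Unitary.mem_iff.1 h.isUnitary).1]
    · rw [← MulOpposite.op_star, ← MulOpposite.op_mul, star_star, MulOpposite.op_eq_one_iff,
        (Unitary.mem_iff.1 h.isUnitary).2]
    · rw [← MulOpposite.op_pow, ← star_pow, h.pow_eq, star_one, MulOpposite.op_one]
    · change MulOpposite.op (star t) * MulOpposite.op (φ (f.comp inv)) *
        star (MulOpposite.op (star t)) = MulOpposite.op _
      rw [← MulOpposite.op_star, ← MulOpposite.op_mul, ← MulOpposite.op_mul, star_star,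
        ← mul_assoc, h.covariant]
      congr 2
      ext g
      exact congrArg f (map_inv σ.symm g).symm
  obtain ⟨F, hF, hFt⟩ := h.exists_lift (NeZero.ne K) hs
  let ιop : Aᵐᵒᵖ →⋆ₐ[ℂ] Dᵐᵒᵖ :=
    { toFun := fun a => MulOpposite.op (ι a.unop)
      map_one' := congrArg MulOpposite.op (map_one ι)
      map_mul' := fun a b => congrArg MulOpposite.op (map_mul ι b.unop a.unop)
      map_zero' := congrArg MulOpposite.op (map_zero ι)
      map_add' := fun a b => congrArg MulOpposite.op (map_add ι a.unop b.unop)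
      commutes' := fun c => congrArg MulOpposite.op (AlgHomClass.commutes ι c)
      map_star' := fun a => congrArg MulOpposite.op (map_star ι a.unop) }
  have hιop : Function.Injective ιop := fun a b hab =>
    MulOpposite.unop_injective (h.injective (MulOpposite.op_injective hab))
  have hx : ∀ i j, F (ι (x i j)) = ιop (MulOpposite.op (star (x j i))) := fun i j => by
    change _ = MulOpposite.op (ι (star (x j i)))
    rw [h.coord, map_mul, hF, hFt, map_star, h.coord, StarMul.star_mul, ← map_star φ]
    change MulOpposite.op (φ ((repCoeff v i j).comp inv)) * _ = _
    rw [← MulOpposite.op_mul]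
    congr 3
    ext g
    exact repCoeff_inv v i j g
  obtain ⟨S, hS⟩ := StarAlgHom.exists_lift_of_injective h.generates_coord (F.comp ι) ιop hιop (by
    rintro _ ⟨p, rfl⟩
    exact ⟨_, (hx p.1 p.2).symm⟩)
  exact ⟨S, fun i j => hιop ((hS _).trans (hx i j))⟩

theorem isUnitary_coord (h : IsBracket σ v φ t Θ ι x) :
    x ∈ unitary (Matrix (Fin N) (Fin N) A) := by
  have hu : x.map ι ∈ unitary (Matrix (Fin N) (Fin N) D) :=
    (h.toIsCovariant.isHalfLiberated v h.coord).isUnitary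
  have hinj : Function.Injective fun M : Matrix (Fin N) (Fin N) A => M.map ι :=
    Matrix.map_injective h.injective
  have hmul : ∀ M M' : Matrix (Fin N) (Fin N) A, (M * M').map ι = M.map ι * M'.map ι :=
    fun M M' => Matrix.map_mul (f := (ι : A →+* D))
  have hstar : (star x).map ι = star (x.map ι) := by
    ext i j
    exact map_star ι (x j i)
  have hone : (1 : Matrix (Fin N) (Fin N) A).map ι = 1 :=
    Matrix.map_one ι (map_zero ι) (map_one ι)
  refine Unitary.mem_iff.2 ⟨hinj ?_, hinj ?_⟩
  · change (star x * x).map ι = (1 : Matrix (Fin N) (Fin N) A).map ι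
    rw [hmul, hstar, hone, (Unitary.mem_iff.1 hu).1]
  · change (x * star x).map ι = (1 : Matrix (Fin N) (Fin N) A).map ι
    rw [hmul, hstar, hone, (Unitary.mem_iff.1 hu).2]

variable [MeasurableSpace L] [BorelSpace L] (μ : Measure L) [μ.IsHaarMeasure]
  [IsProbabilityMeasure μ]

theorem haarTrace_regular_apply (h : IsBracket σ v φ t Θ ι x) (f : C(L, ℂ)) (n : ℕ) :
    haarTrace μ K (Θ (φ f * t ^ n)) = if n % K = 0 then ∫ g, f g ∂μ else 0 := by
  rw [map_mul, map_pow, h.regular_fun, h.regular_gen, haarTrace_regular]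

theorem injective_regular (h : IsBracket σ v φ t Θ ι x) : Function.Injective Θ :=
  h.toIsCrossedProduct.injective_regular Θ h.regular_fun h.regular_gen

/-- The faithful state `tr ⊗ ∫_L` gives faithful vector states on `D` and on `A`. -/
theorem exists_hilbertRep (h : IsBracket σ v φ t Θ ι x) {E : Type u} [CStarAlgebra E]
    (κ : E →⋆ₐ[ℂ] D) (hκ : Function.Injective κ) :
    ∃ (π : HilbertRep E) (Ω : π.H), Function.Injective π.rep ∧
      ∀ a, ⟪Ω, π.rep a Ω⟫_ℂ = haarTrace μ K (Θ (κ a)) :=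
  ((isState_haarTrace μ K).comp (Θ.comp κ)).exists_hilbertRep fun a ha =>
    (injective_iff_map_eq_zero (Θ.comp κ)).1 (h.injective_regular.comp hκ) a
      (eq_zero_of_haarTrace_star_mul_self μ (by
        rw [← map_star, ← map_mul]
        exact ha))

/-- The comultiplications `Δ` of `[L]` and `Δ'` of `L ⋊ ℤ_K`, the embedding `J = ι ⊗ ι` intertwining
them, and the slice maps of the state `(tr ⊗ ∫_L)Θ` in either factor, which express that this state
is invariant under `Δ`. The slices on `A ⊗ A` are restrictions, through `J`, of those on `D ⊗ D`. -/
theorem exists_comul_haar (h : IsBracket σ v φ t Θ ι x) :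
    ∃ (Δ : A →⋆ₐ[ℂ] MinT A A) (Δ' : D →⋆ₐ[ℂ] MinT D D) (J : MinT A A →⋆ₐ[ℂ] MinT D D),
      (∀ i j, Δ (x i j) = ∑ k, MinT.tmul (x i k) (x k j)) ∧
      (∀ (f : C(L, ℂ)) (n : ℕ) (a b : Fin n → C(L, ℂ)),
        (∀ g h, f (g * h) = ∑ m, a m g * b m h) →
          Δ' (φ f) = ∑ m, MinT.tmul (φ (a m)) (φ (b m))) ∧
      Δ' t = MinT.tmul t t ∧
      (∀ a b, J (MinT.tmul a b) = MinT.tmul (ι a) (ι b)) ∧ (∀ a, J (Δ a) = Δ' (ι a)) ∧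
      (∃ R : MinT A A →L[ℂ] A,
        (∀ a b, R (MinT.tmul a b) = haarTrace μ K (Θ (ι a)) • b) ∧
          ∀ a, R (Δ a) = haarTrace μ K (Θ (ι a)) • 1) ∧
      ∃ R : MinT A A →L[ℂ] A,
        (∀ a b, R (MinT.tmul a b) = haarTrace μ K (Θ (ι b)) • a) ∧
          ∀ a, R (Δ a) = haarTrace μ K (Θ (ι a)) • 1 := by
  obtain ⟨T, Δ', hT, hΔ, hΔt⟩ := h.toIsCrossedProduct.exists_comul
  obtain ⟨π, Ω, hπ, hΩ⟩ := h.exists_hilbertRep μ (StarAlgHom.id ℂ D) Function.injective_id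
  obtain ⟨ρ, Ψ, hρ, hΨ⟩ := h.exists_hilbertRep μ ι h.injective
  obtain ⟨J, hJ, hJt⟩ := MinT.exists_map_injective ι ι h.injective h.injective π hπ π hπ
  have hcoord : ∀ i j, Δ' (ι (x i j)) = J (∑ k, MinT.tmul (x i k) (x k j)) := fun i j => by
    rw [h.coord, map_mul, comul_fun_eq_sum hT hΔ (repCoeff v i j) (fun k => repCoeff v i k)
      (fun k => repCoeff v k j) (repCoeff_mul v i j), hΔt, Finset.sum_mul, map_sum]
    refine Finset.sum_congr rfl fun k _ => ?_
    rw [hJt, h.coord, h.coord, MinT.tmul_mul]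
  obtain ⟨Δ, hΔJ⟩ := StarAlgHom.exists_lift_of_injective h.generates_coord (Δ'.comp ι) J hJ (by
    rintro _ ⟨p, rfl⟩
    exact ⟨_, (hcoord p.1 p.2).symm⟩)
  have hst : IsState ((haarTrace μ K).comp Θ.toAlgHom.toLinearMap) :=
    (isState_haarTrace μ K).comp Θ
  let χ : D →L[ℂ] ℂ := ⟨(haarTrace μ K).comp Θ.toAlgHom.toLinearMap, hst.continuous⟩
  have hχ : ∀ f n, χ (φ f * t ^ n) = if n % K = 0 then ∫ g, f g ∂μ else 0 :=
    h.haarTrace_regular_apply μ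
  refine ⟨Δ, Δ', J, fun i j => hJ ((hΔJ _).trans (hcoord i j)),
    fun f n a b hf => comul_fun_eq_sum hT hΔ f a b hf, hΔt, hJt, hΔJ, ?_, ?_⟩
  · obtain ⟨R, hR, -⟩ := MinT.exists_leftSlice ρ hρ ρ Ψ Ψ
    obtain ⟨R', hR', -⟩ := MinT.exists_leftSlice π hπ π Ω Ω
    have hR2 : ∀ a b, R' (MinT.tmul a b) = χ a • b := fun a b => by rw [hR', hΩ]; rfl
    have hRR : ∀ z, ι (R z) = R' (J z) := fun z => by
      have hext : ι.toCLM.comp R = R'.comp J.toCLM := MinT.clm_ext fun a b => by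
        change ι (R (MinT.tmul a b)) = R' (J (MinT.tmul a b))
        rw [hR, hJt, hR2, map_smul, hΨ]
        rfl
      exact DFunLike.congr_fun hext z
    refine ⟨R, fun a b => by rw [hR, hΨ], fun a => h.injective ?_⟩
    rw [hRR, hΔJ, map_smul, map_one]
    exact h.toIsCrossedProduct.leftSlice_comul μ hT hΔ hΔt hχ hR2 (ι a)
  · obtain ⟨R, hR, -⟩ := MinT.exists_rightSlice ρ hρ ρ Ψ Ψ
    obtain ⟨R', hR', -⟩ := MinT.exists_rightSlice π hπ π Ω Ω
    have hR2 : ∀ a b, R' (MinT.tmul a b) = χ b • a := fun a b => by rw [hR', hΩ]; rfl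
    have hRR : ∀ z, ι (R z) = R' (J z) := fun z => by
      have hext : ι.toCLM.comp R = R'.comp J.toCLM := MinT.clm_ext fun a b => by
        change ι (R (MinT.tmul a b)) = R' (J (MinT.tmul a b))
        rw [hR, hJt, hR2, map_smul, hΨ]
        rfl
      exact DFunLike.congr_fun hext z
    refine ⟨R, fun a b => by rw [hR, hΨ], fun a => h.injective ?_⟩
    rw [hRR, hΔJ, map_smul, map_one]
    exact h.toIsCrossedProduct.rightSlice_comul μ hT hΔ hΔt hχ hR2 (ι a)

/-- The counterpart of `exists_comul_haar` for the tensor products `MinTensor`. -/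
theorem exists_quantumGroup (h : IsBracket σ v φ t Θ ι x) :
    IsCompactMatrixQuantumGroup x ∧
    ∃ (Δ : A →⋆ₐ[ℂ] MinTensor A A) (Δ' : D →⋆ₐ[ℂ] MinTensor D D),
      IsMatrixComul x Δ ∧
      IsStationaryModel Δ μ (Θ.comp ι) ∧
      (∀ (f : C(L, ℂ)) (n : ℕ) (a b : Fin n → C(L, ℂ)),
        (∀ g h, f (g * h) = ∑ m, a m g * b m h) →
          Δ' (φ f) = ∑ m, minTmul (φ (a m)) (φ (b m))) ∧
      Δ' t = minTmul t t ∧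
      IsQuotientEmbedding Δ Δ' ι := by
  obtain ⟨Δ, Δ', J, hΔ, hΔf, hΔt, hJt, hJ, ⟨R, hR, hRΔ⟩, S, hS, hSΔ⟩ := h.exists_comul_haar μ
  have hcom : IsMatrixComul x ((MinT.toMinTensor A A).comp Δ) := fun i j => by
    rw [StarAlgHom.comp_apply, hΔ]
    exact MinT.toMinTensor_sum_tmul _ _
  refine ⟨⟨h.isUnitary_coord, h.generates_coord, ⟨_, hcom⟩, h.exists_counit,
    h.exists_antipode⟩, _, (MinT.toMinTensor D D).comp Δ', hcom, ?_, ?_, ?_, h.injective,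
    ((MinT.toMinTensor D D).comp J).comp (MinT.ofMinTensor A A), ?_, ?_⟩
  · have hst : IsState ((haarTrace μ K).comp (Θ.comp ι).toAlgHom.toLinearMap) :=
      (isState_haarTrace μ K).comp (Θ.comp ι)
    refine ⟨_, ⟨hst, fun ψ hψ => ?_, fun ψ hψ => ?_⟩, fun a => rfl⟩
    · let ψc : A →L[ℂ] ℂ := ⟨ψ, hψ.continuous⟩
      refine ⟨(ψc.comp R).comp (MinT.ofMinTensorCLM A A), fun a b => ?_, fun a => ?_⟩
      · change ψ (R (MinT.tmul a b)) = _
        rw [hR, map_smul]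
        rfl
      · change ψ (R (Δ a)) = _
        rw [hRΔ, map_smul, hψ.2, smul_eq_mul, mul_one]
        rfl
    · let ψc : A →L[ℂ] ℂ := ⟨ψ, hψ.continuous⟩
      refine ⟨(ψc.comp S).comp (MinT.ofMinTensorCLM A A), fun a b => ?_, fun a => ?_⟩
      · change ψ (S (MinT.tmul a b)) = _
        rw [hS, map_smul, smul_eq_mul, mul_comm]
        rfl
      · change ψ (S (Δ a)) = _
        rw [hSΔ, map_smul, hψ.2, smul_eq_mul, mul_one]
        rfl
  · intro f n a b hf
    rw [StarAlgHom.comp_apply, hΔf f n a b hf]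
    exact MinT.toMinTensor_sum_tmul _ _
  · rw [StarAlgHom.comp_apply, hΔt]
    rfl
  · intro a b
    exact congrArg (MinT.toMinTensor D D) (hJt a b)
  · intro a
    exact congrArg (MinT.toMinTensor D D) (hJ a)

/-- A model of a universal algebra sending the coordinates to the matrices `τ[v_ij^(1), …]` factors
through `C([L])`, because these matrices are the images of the coordinates of `[L]` under the
faithful regular representation. -/
theorem exists_stationaryOnImage (h : IsBracket σ v φ t Θ ι x) {C : Type w} [CStarAlgebra C]
    {y : Matrix (Fin N) (Fin N) C}
    (hy : cstarGenerated (Set.range fun p : Fin N × Fin N => y p.1 p.2) = ⊤)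
    (hx : IsCompactMatrixQuantumGroup x)
    (π : C →⋆ₐ[ℂ] CStarMatrix (Fin K) (Fin K) C(L, ℂ))
    (hπ : ∀ i j, π (y i j) = regularFun σ K (repCoeff v i j) * cyclicShift L K) :
    ∃ q : C →⋆ₐ[ℂ] A, (∀ i j, q (y i j) = x i j) ∧
      IsStationaryOnImage.{w, _, u, w'} y π q (Θ.comp ι) := by
  have hinj : Function.Injective (Θ.comp ι) := h.injective_regular.comp h.injective
  have hθ : ∀ i j, (Θ.comp ι) (x i j) = π (y i j) := fun i j => by
    rw [hπ, StarAlgHom.comp_apply, h.coord, map_mul, h.regular_fun, h.regular_gen]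
  obtain ⟨q, hq⟩ := StarAlgHom.exists_lift_of_injective hy π (Θ.comp ι) hinj (by
    rintro _ ⟨p, rfl⟩
    exact ⟨_, hθ p.1 p.2⟩)
  have hqx : ∀ i j, q (y i j) = x i j := fun i j => hinj ((hq _).trans (hθ i j).symm)
  have hfac : (Θ.comp ι).comp q = π := StarAlgHom.ext hq
  have hsurj : Function.Surjective q :=
    StarAlgHom.surjective_of_cstarGenerated_eq_top q h.generates_coord (by
      rintro _ ⟨p, rfl⟩
      exact ⟨_, hqx p.1 p.2⟩)
  have hsub : IsClosedQuantumSubgroup y q := by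
    have : (fun i j => q (y i j) : Matrix (Fin N) (Fin N) A) = x := by
      ext i j
      exact hqx i j
    rw [IsClosedQuantumSubgroup, this]
    exact hx
  refine ⟨q, hqx, ⟨hsub, ⟨_, hfac⟩, fun A' _ q' hq' hθ' => ?_⟩, hfac, hinj, ?_⟩
  · obtain ⟨θ', hθ'⟩ := hθ'
    have hθq : ∀ c, θ' (q' c) = π c := fun c => DFunLike.congr_fun hθ' c
    obtain ⟨r, hr⟩ := StarAlgHom.exists_lift_of_injective hq'.generates θ' (Θ.comp ι) hinj (by
      rintro _ ⟨p, rfl⟩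
      exact ⟨_, (hθ p.1 p.2).trans (hθq _).symm⟩)
    exact ⟨r, StarAlgHom.ext fun c => hinj ((hr _).trans ((hθq c).trans (hq c).symm))⟩
  · rw [← hfac]
    exact (hsurj.range_comp (Θ.comp ι)).symm

end IsBracket

end Brackets

/-! ### The universal algebras -/

noncomputable section Universal

open scoped CStarAlgebra

variable {L : Type u} [Group L] [TopologicalSpace L] [CompactSpace L] {σ : L ≃ₜ* L} {K N : ℕ}

theorem regularFun_mul_cyclicShift [NeZero K] (v : L →ₜ* Matrix.unitaryGroup (Fin N) ℂ)
    (i j : Fin N) : regularFun σ K (repCoeff v i j) * cyclicShift L K =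
      cycleFill K fun r : Fin K => repCoeffIter σ v ((r : ℕ) + 1) i j := by
  ext1 r s
  rw [regularFun_mul, cyclicShift_apply]
  change _ = if r = s + 1 then repCoeffIter σ v ((r : ℕ) + 1) i j else 0
  split_ifs
  · rw [mul_one]
    rfl
  · rw [mul_zero]

/-- The regular representation, as one of the covariant pairs defining `CCrossed`. -/
def regularPair [NeZero K] (hσ : ∀ g, σ^[K] g = g) : CovariantPair σ K where
  B := CStarMatrix (Fin K) (Fin K) C(L, ℂ)
  nontrivial := ⟨⟨1, 0, fun h => by
    have h0 : ((1 : CStarMatrix (Fin K) (Fin K) C(L, ℂ)) 0 0 : C(L, ℂ)) 1 = 0 := by rw [h]; rfl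
    simp at h0⟩⟩
  φ := regularFun σ K
  t := cyclicShift L K
  isUnitary := (isCovariant_regular hσ).isUnitary
  pow_eq := (isCovariant_regular hσ).pow_eq
  covariant := (isCovariant_regular hσ).covariant

variable (σ K) in
/-- The universal copy of `C(L)` in `C(L) ⋊ ℤ_K`, as a morphism. -/
def crossedHom : C(L, ℂ) →⋆ₐ[ℂ] CCrossed σ K where
  toFun := crossedFun σ K
  map_one' := Subtype.ext (lp.ext (funext fun p => map_one p.φ))
  map_mul' f g := Subtype.ext (lp.ext (funext fun p => map_mul p.φ f g))
  map_zero' := Subtype.ext (lp.ext (funext fun p => map_zero p.φ))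
  map_add' f g := Subtype.ext (lp.ext (funext fun p => map_add p.φ f g))
  commutes' c := Subtype.ext (lp.ext (funext fun p => AlgHomClass.commutes p.φ c))
  map_star' f := Subtype.ext (lp.ext (funext fun p => map_star p.φ f))

/-- Evaluation of `C(L) ⋊ ℤ_K` at a covariant pair. -/
def crossedEval (p : CovariantPair σ K) : CCrossed σ K →⋆ₐ[ℂ] p.B where
  toFun x := x.1.1 p
  map_one' := rfl
  map_mul' _ _ := rfl
  map_zero' := rfl
  map_add' _ _ := rfl
  commutes' _ := rfl
  map_star' _ := rfl

theorem isCovariant_crossed : IsCovariant σ K (crossedHom σ K) (crossedGen σ K) where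
  isUnitary := Unitary.mem_iff.2
    ⟨Subtype.ext (lp.ext (funext fun p => (Unitary.mem_iff.1 p.isUnitary).1)),
      Subtype.ext (lp.ext (funext fun p => (Unitary.mem_iff.1 p.isUnitary).2))⟩
  pow_eq := Subtype.ext (lp.ext (funext fun p =>
    (map_pow (crossedEval p) (crossedGen σ K) K).trans p.pow_eq))
  covariant f := Subtype.ext (lp.ext (funext fun p => p.covariant f))

theorem cstarGenerated_crossed :
    cstarGenerated (Set.range (crossedHom σ K) ∪ {crossedGen σ K}) = ⊤ := by
  refine cstarGenerated_eq_top_of_le (le_of_eq (congrArg _ ?_))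
  rw [Set.image_union, Set.image_singleton, ← Set.range_comp]
  rfl

/-- Evaluation of `C(U_N^*)` at a half-liberated matrix. -/
def unStarEval (p : HalfLiberatedMatrix.{u} N) : CUNStar.{u} N →⋆ₐ[ℂ] p.B where
  toFun x := x.1.1 p
  map_one' := rfl
  map_mul' _ _ := rfl
  map_zero' := rfl
  map_add' _ _ := rfl
  commutes' _ := rfl
  map_star' _ := rfl

theorem cstarGenerated_unStarCoord :
    cstarGenerated (Set.range fun p : Fin N × Fin N => unStarCoord.{u} p.1 p.2) = ⊤ := by
  have h : cstarGenerated
      (Set.range fun p : Fin N × Fin N => halfLiberatedAmbientCoord.{u} p.1 p.2) ≤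
      cstarGenerated (Subtype.val '' (Set.range fun p : Fin N × Fin N =>
        unStarCoord.{u} p.1 p.2)) := by
    refine le_of_eq (congrArg _ ?_)
    rw [← Set.range_comp]
    rfl
  exact cstarGenerated_eq_top_of_le h

theorem cstarGenerated_bracketCoord (v : L →ₜ* Matrix.unitaryGroup (Fin N) ℂ) :
    cstarGenerated (Set.range fun p : Fin N × Fin N => bracketCoord σ K v p.1 p.2) = ⊤ := by
  have h : cBracket σ K v ≤ cstarGenerated (Subtype.val ''
      (Set.range fun p : Fin N × Fin N => bracketCoord σ K v p.1 p.2)) := by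
    refine le_of_eq (congrArg cstarGenerated ?_)
    rw [← Set.range_comp]
    rfl
  exact cstarGenerated_eq_top_of_le h

variable [IsTopologicalGroup L] [T2Space L] [NeZero K]

theorem isBracket_cBracket (hσ : ∀ g, σ^[K] g = g) (v : L →ₜ* Matrix.unitaryGroup (Fin N) ℂ) :
    IsBracket σ v (crossedHom σ K) (crossedGen σ K) (crossedEval (regularPair hσ))
      (cBracket σ K v).subtype (bracketCoord σ K v) where
  toIsCrossedProduct := IsCrossedProduct.of_regular isCovariant_crossed cstarGenerated_crossed
    (crossedEval (regularPair hσ)) (fun _ => rfl) rfl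
  regular_fun _ := rfl
  regular_gen := rfl
  injective := Subtype.val_injective
  coord _ _ := rfl
  generates_coord := cstarGenerated_bracketCoord v

theorem exists_isCyclicModel (hσ : ∀ g, σ^[K] g = g) (v : L →ₜ* Matrix.unitaryGroup (Fin N) ℂ) :
    ∃ π : CUNStar.{u} N →⋆ₐ[ℂ] CStarMatrix (Fin K) (Fin K) C(L, ℂ), IsCyclicModel σ K v π :=
  ⟨unStarEval
    { B := CStarMatrix (Fin K) (Fin K) C(L, ℂ)
      nontrivial := (regularPair hσ).nontrivial
      coord := fun i j => regularFun σ K (repCoeff v i j) * cyclicShift L K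
      rel := (isCovariant_regular hσ).isHalfLiberated v fun _ _ => rfl },
    regularFun_mul_cyclicShift v⟩

end Universal

set_option maxHeartbeats 400000 in
theorem theorem4p4 {L : Type u} [Group L] [TopologicalSpace L] [IsTopologicalGroup L]
    [CompactSpace L] [T2Space L] [MeasurableSpace L] [BorelSpace L]
    (μ : Measure L) [μ.IsHaarMeasure] [IsProbabilityMeasure μ]
    {N K : ℕ} [NeZero K] (v : L →ₜ* Matrix.unitaryGroup (Fin N) ℂ)
    (σ : L ≃ₜ* L) (hσ : ∀ g, σ^[K] g = g) :
    (∃ π : CUNStar.{u} N →⋆ₐ[ℂ] CStarMatrix (Fin K) (Fin K) C(L, ℂ), IsCyclicModel σ K v π) ∧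
    ∀ π : CUNStar.{u} N →⋆ₐ[ℂ] CStarMatrix (Fin K) (Fin K) C(L, ℂ), IsCyclicModel σ K v π →
      ∃ (q : CUNStar.{u} N →⋆ₐ[ℂ] cBracket σ K v)
        (θ : cBracket σ K v →⋆ₐ[ℂ] CStarMatrix (Fin K) (Fin K) C(L, ℂ))
        (Δ : cBracket σ K v →⋆ₐ[ℂ] MinTensor (cBracket σ K v) (cBracket σ K v))
        (Δ' : CCrossed σ K →⋆ₐ[ℂ] MinTensor (CCrossed σ K) (CCrossed σ K)),
        (∀ i j, q (unStarCoord i j) = bracketCoord σ K v i j) ∧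
        IsStationaryOnImage.{u + 1, u, u + 1, w} (A := cBracket σ K v) unStarCoord π q θ ∧
        IsMatrixComul (bracketCoord σ K v) Δ ∧
        IsStationaryModel Δ μ θ ∧
        IsCrossedComul σ K Δ' ∧
        IsQuotientEmbedding Δ Δ' (cBracket σ K v).subtype := by
  refine ⟨exists_isCyclicModel hσ v, fun π hπ => ?_⟩
  have h := isBracket_cBracket hσ v
  obtain ⟨hx, Δ, Δ', hΔ, hstat, hfun, hgen, hquot⟩ := h.exists_quantumGroup μ
  obtain ⟨q, hq, himage⟩ :=
    h.exists_stationaryOnImage.{_, _, w} cstarGenerated_unStarCoord hx π fun i j =>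
      (hπ i j).trans (regularFun_mul_cyclicShift v i j).symm
  exact ⟨q, _, Δ, Δ', hq, himage, hΔ, hstat, ⟨hfun, hgen⟩, hquot⟩
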